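/- **Definitions.** For an Ore domain $A$ let $\operatorname{Frac}A$ be its skew field of fractions and $Z(A)$ its centre. $A_n(K)$ is the Weyl algebra over $K$ (generators $x_1,\dots,x_n,y_1,\dots,y_n$, relations $[x_i,x_j]=[y_i,y_j]=0$, $[y_i,x_j]=\delta_{ij}$), and for a field $\mathbf k$ let $\mathbb D_{n,l}(\mathbf k)=\operatorname{Frac}A_n(\mathbf k(t_1,\dots,t_l))$. The Gelfand–Kirillov transcendence degree of a $\mathbf k$-algebra $D$ is $\operatorname{Tdeg}D=\sup_V\inf_b\,\limsup_{r\to\infty}\frac{\log\dim_{\mathbf k}(\mathbf k+bV)^r}{\log r}$, where $V$ ranges over the finite-dimensional subspaces and $b$ over the regular elements of $D$. Let $A_{\mathbb Z}$ be a ring and $A_{\mathbf k}=A_{\mathbb Z}\otimes_{\mathbb Z}\mathbf k$ for every algebraically closed field $\mathbf k$ of any characteristic. The family $\mathcal K=\{A_{\mathbf k}\}$ is *$\mathbb Z$-compatible* if: 1. $A_{\mathbb Z}$ and all $A_{\mathbf k}$ are Ore domains. 2. There is an exhaustive filtration $A_0\subseteq A_1\subseteq\cdots$ of $A_{\mathbb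 Z}$ such that $A_0=\mathbb Z$, such that $A_i=(A_1)^i$ is a finitely generated free abelian group for $i\ge1$, and such that $A_i^{\mathbf k}=A_i\otimes_{\mathbb Z}\mathbf k$ embeds in $A_{\mathbf k}$ for all $i$ and $\mathbf k$. Moreover, either $\operatorname{Tdeg}\operatorname{Frac}A_{\mathbf k}=\dim_{\mathbf k}A_1^{\mathbf k}$ for all $\mathbf k$, or $\operatorname{Tdeg}\operatorname{Frac}A_{\mathbf k}=\dim_{\mathbf k}A_1^{\mathbf k}-1$ (the dimension of $A_1^{\mathbf k}$ modulo scalars) for all $\mathbf k$. 3. For $\mathbf k$ of characteristic $0$, $Z(\operatorname{Frac}A_{\mathbf k})\cong\operatorname{Frac}Z(A_{\mathbf k})$ as $\mathbf k$-algebras. 4. There are $s\ge 0$ and $x_1,\dots,x_s\in A_{\mathbb Z}$ such that, for all $\mathbf k$ of characteristic $0$, $Z(A_{\mathbf k})$ is the polynomial algebra $\mathbf k[x_1,\dots,x_s]$ in the images of the $x_i$, and such that, for all $\mathbf k$ of prime characteristic, the images of the $x_i$ in $A_{\mathbf k}$ are central. For $\mathbf k$ of characteristic $0$, the *Gelfand–Kirillov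 Conjecture holds for $A_{\mathbf k}$* if $\operatorname{Frac}A_{\mathbf k}\cong\mathbb D_{n,l}(\mathbf k)$ as $\mathbf k$-algebras for some $n,l\ge0$ with $\operatorname{Tdeg}\operatorname{Frac}A_{\mathbf k}=2n+l$ and $l=\operatorname{trdeg}_{\mathbf k}\operatorname{Frac}Z(A_{\mathbf k})$. Elements $w_1,\dots,w_{2m}$ of $\operatorname{Frac}A_{\mathbf k}$ are *Weyl generators* if $[w_i,w_j]=[w_{m+i},w_{m+j}]=0$ and $[w_i,w_{m+j}]=\delta_{ij}$ for $1\le i,j\le m$, and every element of $\operatorname{Frac}A_{\mathbf k}$ has the form $q^{-1}p$ with $p$ and $q\neq0$ polynomials in the $w_i$ with coefficients in $Z(\operatorname{Frac}A_{\mathbf k})$. **Theorem.** Let $\{A_{\mathbf k}\}$ be a $\mathbb Z$-compatible family. Then there are $N\ge 0$ and finite sets $F,G\subset\mathbb Z[T_1,\dots,T_N]$, depending only on the family, such that for every algebraically closed field $\mathbf k$ of characteristic $0$ the locally closed subvariety $$X^{\mathbf k}=\{z\in\mathbf k^N:\ f(z)=0\ \text{for all } f\in F,\ \ g(z)\ne0\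 \text{for some } g\in G\}$$ of $\mathbf k^N$ satisfies: the Gelfand–Kirillov Conjecture holds for $A_{\mathbf k}$ if and only if $X^{\mathbf k}\neq\varnothing$. Moreover, $X^{\mathbf k}$ encodes Weyl generators: $F$ and $G$ can be chosen together with an $m\ge 0$ and elements $a_i,b_i\in\mathbb Z[T_1,\dots,T_N]\otimes_{\mathbb Z}A_{\mathbb Z}$ $(1\le i\le 2m)$ such that, for every such $\mathbf k$ and every $z\in X^{\mathbf k}$, the values $b_i(z)\in A_{\mathbf k}$ are nonzero and the elements $w_i=b_i(z)^{-1}a_i(z)$ are Weyl generators of $\operatorname{Frac}A_{\mathbf k}$. -/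

import Mathlib

open scoped TensorProduct nonZeroDivisors

universe u v

noncomputable section

/-! ## Ore domains and their skew fields of fractions -/

/-- A (two-sided) Ore domain: a not necessarily commutative domain in which any two nonzero
elements have a common nonzero left multiple and a common nonzero right multiple. -/
class IsOreDomain (A : Type*) [Ring A] : Prop extends IsDomain A where
  left_ore : ∀ a b : A, b ≠ 0 → ∃ c d : A, d ≠ 0 ∧ d * a = c * b
  right_ore : ∀ a b : A, b ≠ 0 → ∃ c d : A, d ≠ 0 ∧ a * d = b * c

/-- The nonzero elements of an Ore domain form an Ore set in the sense of Mathlib. -/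
instance (priority := low) IsOreDomain.oreSet (A : Type*) [Ring A] [h : IsOreDomain A] :
    OreLocalization.OreSet A⁰ :=
  OreLocalization.oreSetOfNoZeroDivisors
    (fun a b => (h.left_ore a b (nonZeroDivisors.coe_ne_zero b)).choose)
    (fun a b => ⟨(h.left_ore a b (nonZeroDivisors.coe_ne_zero b)).choose_spec.choose,
      mem_nonZeroDivisors_of_ne_zero
        (h.left_ore a b (nonZeroDivisors.coe_ne_zero b)).choose_spec.choose_spec.1⟩)
    (fun a b => (h.left_ore a b (nonZeroDivisors.coe_ne_zero b)).choose_spec.choose_spec.2)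

/-- `Frac A`, the skew field of fractions of an Ore domain `A`: the Ore localization of `A` at
all its nonzero elements. -/
abbrev SkewFrac (A : Type*) [Ring A] [IsOreDomain A] : Type _ :=
  @OreLocalization A _ A⁰ (IsOreDomain.oreSet A) A _

/-- The canonical embedding `A → Frac A`. -/
def SkewFrac.of (A : Type*) [Ring A] [IsOreDomain A] : A →+* SkewFrac A :=
  OreLocalization.numeratorRingHom

/-- `ι : A → D` exhibits the division ring `D` as a skew field of fractions of `A`:
`ι` is injective and each element of `D` has the form `ι(b)⁻¹ ι(a)` with `b ≠ 0`. -/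
structure IsSkewFieldOfFractions {A D : Type*} [Ring A] [DivisionRing D] (ι : A →+* D) :
    Prop where
  injective : Function.Injective ι
  exists_frac : ∀ d : D, ∃ a b : A, b ≠ 0 ∧ d = (ι b)⁻¹ * ι a

/-! ## Weyl algebras and Weyl fields -/

/-- The defining relations of the `n`-th Weyl algebra; `Sum.inl i` is the index of `x_i` and
`Sum.inr i` is the index of `y_i`. -/
inductive WeylRel (n : ℕ) (K : Type*) [CommRing K] :
    FreeAlgebra K (Fin n ⊕ Fin n) → FreeAlgebra K (Fin n ⊕ Fin n) → Prop
  | xx (i j : Fin n) : WeylRel n K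
      (FreeAlgebra.ι K (Sum.inl i) * FreeAlgebra.ι K (Sum.inl j))
      (FreeAlgebra.ι K (Sum.inl j) * FreeAlgebra.ι K (Sum.inl i))
  | yy (i j : Fin n) : WeylRel n K
      (FreeAlgebra.ι K (Sum.inr i) * FreeAlgebra.ι K (Sum.inr j))
      (FreeAlgebra.ι K (Sum.inr j) * FreeAlgebra.ι K (Sum.inr i))
  | yx (i j : Fin n) : WeylRel n K
      (FreeAlgebra.ι K (Sum.inr i) * FreeAlgebra.ι K (Sum.inl j))
      (FreeAlgebra.ι K (Sum.inl j) * FreeAlgebra.ι K (Sum.inr i) + if i = j then 1 else 0)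

/-- The `n`-th Weyl algebra `A_n(K)`, by generators and relations. -/
abbrev WeylAlgebra (n : ℕ) (K : Type*) [CommRing K] : Type _ := RingQuot (WeylRel n K)

/-- The field of rational functions `k(t_1, …, t_l)`. -/
abbrev RationalFunctions (l : ℕ) (k : Type*) [Field k] : Type _ :=
  FractionRing (MvPolynomial (Fin l) k)

/-- `A_{n,l}(k) = A_n(k(t_1, …, t_l))`. -/
abbrev WeylAlgebraRat (n l : ℕ) (k : Type*) [Field k] : Type _ :=
  WeylAlgebra n (RationalFunctions l k)

/-- The `k`-division algebra `D` is the Weyl field `𝔻_{n,l}(k)`, i.e. (up to `k`-isomorphism)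
the skew field of fractions of `A_{n,l}(k)`. -/
def IsWeylField (k : Type*) [Field k] (n l : ℕ) (D : Type*) [DivisionRing D] [Algebra k D] :
    Prop :=
  ∃ ι : WeylAlgebraRat n l k →ₐ[k] D, IsSkewFieldOfFractions (ι : WeylAlgebraRat n l k →+* D)

/-! ## Gelfand–Kirillov transcendence degree -/

/-- For a finite dimensional subspace `W` of a `k`-algebra `D`, the Gelfand–Kirillov dimension
of the subalgebra `k[W]`, i.e. `limsup_n log dim (k + W)^n / log n`. -/
def gkDimAdjoin (k : Type*) [Field k] {D : Type*} [Ring D] [Algebra k D] (W : Submodule k D) :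
    EReal :=
  Filter.limsup
    (fun n : ℕ =>
      ((Real.log (Module.finrank k ↥((1 ⊔ W) ^ n)) / Real.log n : ℝ) : EReal)) Filter.atTop

/-- The Gelfand–Kirillov transcendence degree `Tdeg D = sup_V inf_b GKdim k[bV]`; here `V` ranges
over the finite dimensional subspaces and `b` over the regular elements of `D`. -/
def gkTdeg (k : Type*) [Field k] (D : Type*) [Ring D] [Algebra k D] : EReal :=
  ⨆ V : {V : Submodule k D // V.FG}, ⨅ b : D⁰,
    gkDimAdjoin k (V.1.map (LinearMap.mulLeft k (b : D)))

/-- The Gelfand–Kirillov Conjecture holds for the Ore domain `A` over `k`: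
`Frac A ≅ 𝔻_{n,l}(k)`, where `Tdeg Frac A = 2n + l` and `l = tdeg Frac Z(A)`. -/
def GelfandKirillovHolds (k : Type*) [Field k] (A : Type*) [Ring A] [Algebra k A]
    [IsOreDomain A] : Prop :=
  ∃ n l : ℕ,
    gkTdeg k (SkewFrac A) = ((2 * n + l : ℕ) : EReal) ∧
    Algebra.trdeg k (FractionRing (Subalgebra.center k A)) = (l : Cardinal) ∧
    IsWeylField k n l (SkewFrac A)

/-! ## `ℤ`-compatible families -/

/-- A filtration `A_0 ⊆ A_1 ⊆ …` of the ring `R = A_ℤ` with `A_0 = ℤ`, with `A_i = A_1 ^ i`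
a finitely generated free abelian group for `i ≥ 1`, and such that, for all algebraically closed
fields `k`, the groups `k ⊗ A_i` are subspaces of `k ⊗ A_ℤ` (and so filter it). -/
structure IsIntegralFiltration (R : Type v) [Ring R] (F : ℕ → Submodule ℤ R) : Prop where
  mono : Monotone F
  exhaustive : ∀ r : R, ∃ i, r ∈ F i
  zero : F 0 = 1
  pow : ∀ i, 1 ≤ i → F i = F 1 ^ i
  free : ∀ i, 1 ≤ i → Module.Free ℤ (F i)
  finite : ∀ i, 1 ≤ i → Module.Finite ℤ (F i)
  baseChange_injective : ∀ (k : Type u) [Field k] [IsAlgClosed k] (i : ℕ),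
    Function.Injective (LinearMap.lTensor k (F i).subtype)

/-- The family `A_k = k ⊗ A_ℤ` (`k` ranging over all algebraically closed fields, of any
characteristic) attached to the ring `R = A_ℤ` is `ℤ`-compatible.

In `exists_filtration`, the transcendence degree is `dim A_1^k` in the first alternative, and the
dimension `dim A_1^k - 1` of `A_1^k` modulo the scalars in the second one (which is the
normalization for standard filtrations of enveloping algebras and Weyl algebras). -/
structure IsZCompatible (R : Type v) [Ring R] : Prop where
  isOreDomain_int : IsOreDomain R
  isOreDomain : ∀ (k : Type u) [Field k] [IsAlgClosed k], IsOreDomain (k ⊗[ℤ] R)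
  exists_filtration : ∃ F : ℕ → Submodule ℤ R, IsIntegralFiltration.{u} R F ∧
    ((∀ (k : Type u) [Field k] [IsAlgClosed k],
        haveI := isOreDomain k
        gkTdeg k (SkewFrac (k ⊗[ℤ] R)) =
          ((Module.finrank k ((F 1).baseChange k) : ℕ) : EReal)) ∨
      (∀ (k : Type u) [Field k] [IsAlgClosed k],
        haveI := isOreDomain k
        gkTdeg k (SkewFrac (k ⊗[ℤ] R)) + 1 =
          ((Module.finrank k ((F 1).baseChange k) : ℕ) : EReal)))
  center_skewFrac : ∀ (k : Type u) [Field k] [IsAlgClosed k] [CharZero k],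
    haveI := isOreDomain k
    Nonempty (Subalgebra.center k (SkewFrac (k ⊗[ℤ] R)) ≃ₐ[k]
      FractionRing (Subalgebra.center k (k ⊗[ℤ] R)))
  center_polynomial : ∃ (s : ℕ) (x : Fin s → R),
    (∀ (k : Type u) [Field k] [IsAlgClosed k] [CharZero k],
      ∃ hx : ∀ i, (1 : k) ⊗ₜ[ℤ] x i ∈ Subalgebra.center k (k ⊗[ℤ] R),
        Function.Bijective (MvPolynomial.aeval
          (fun i => (⟨(1 : k) ⊗ₜ[ℤ] x i, hx i⟩ : Subalgebra.center k (k ⊗[ℤ] R))) :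
            MvPolynomial (Fin s) k →ₐ[k] Subalgebra.center k (k ⊗[ℤ] R))) ∧
    (∀ (p : ℕ) [Fact p.Prime] (k : Type u) [Field k] [IsAlgClosed k] [CharP k p] (i : Fin s),
      (1 : k) ⊗ₜ[ℤ] x i ∈ Subalgebra.center k (k ⊗[ℤ] R))

/-! ## The variety and the Weyl generators -/

/-- The locally closed subset of `k^N` cut out by integer polynomials: the common zeros of all
`f ∈ F` at which some `g ∈ G` does not vanish. -/
def integralLocallyClosed {N : ℕ} (F G : Finset (MvPolynomial (Fin N) ℤ)) (k : Type*) [Field k] :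
    Set (Fin N → k) :=
  {z | (∀ f ∈ F, MvPolynomial.aeval z f = 0) ∧ ∃ g ∈ G, MvPolynomial.aeval z g ≠ 0}

/-- Specialization of an element of `ℤ[T_1, …, T_N] ⊗ A_ℤ` at a point `z` of `k^N`; the result is
an element of `A_k = k ⊗ A_ℤ`. -/
def specialize (R : Type v) [Ring R] {N : ℕ} {k : Type u} [Field k] (z : Fin N → k) :
    MvPolynomial (Fin N) ℤ ⊗[ℤ] R →ₐ[ℤ] k ⊗[ℤ] R :=
  Algebra.TensorProduct.map (MvPolynomial.aeval z) (AlgHom.id ℤ R)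

/-- Elements `w_1, …, w_m, w_{m+1}, …, w_{2m}` of `Frac A` that satisfy the Weyl relations and
generate the skew field `Frac A` over its centre: each element of `Frac A` has the form `q⁻¹ p`,
where `p` and `q` are polynomials in the `w`'s with central coefficients. -/
structure IsWeylGenerators (k : Type*) [Field k] (A : Type*) [Ring A] [Algebra k A]
    [IsOreDomain A] (m : ℕ) (w : Fin m ⊕ Fin m → SkewFrac A) : Prop where
  comm_left : ∀ i j, w (Sum.inl i) * w (Sum.inl j) = w (Sum.inl j) * w (Sum.inl i)
  comm_right : ∀ i j, w (Sum.inr i) * w (Sum.inr j) = w (Sum.inr j) * w (Sum.inr i)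
  comm_mixed : ∀ i j, w (Sum.inl i) * w (Sum.inr j) - w (Sum.inr j) * w (Sum.inl i) =
    if i = j then 1 else 0
  exists_frac : ∀ d : SkewFrac A,
    ∃ p ∈ Algebra.adjoin k (Set.range w ∪ (Subalgebra.center k (SkewFrac A) : Set (SkewFrac A))),
    ∃ q ∈ Algebra.adjoin k (Set.range w ∪ (Subalgebra.center k (SkewFrac A) : Set (SkewFrac A))),
      q ≠ 0 ∧ q * d = p

end

/-!
A presentation of `Frac A_k` as a Weyl skew field is finite data: elements `w` that satisfy the
Weyl relations, elements `t` commuting with finitely many generators of `A_ℤ`, expressions of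
these generators as left fractions in `w` and `t`, and equations over `k[t]` satisfied by the
central elements `x_i`. Conversely, such data suffice in characteristic `0`: the `t_i` are
central, and they are algebraically independent because the independent `x_i` are algebraic over
them; and `A_n(k(t))` embeds, as it is simple, with an Ore condition due to polynomial growth.

If the conjecture holds over some `k₀`, write the data as fractions of elements of `P ⊗ A_ℤ`,
where `P` is the polynomial ring over `ℤ` in the elements of `k₀`. The finitely many identities
and inequations that hold at the tautological point `η : P → k₀` hold at every point where
finitely many `p ∈ P` vanish and finitely many others do not: otherwise a reduced product of the
skew fields `Frac A_k`, over points approaching `η`, would violate them. These conditions define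
`X`, which has a point over `k₀` and hence, by the Nullstellensatz, over every `k`. If the
conjecture fails over every `k`, the empty `X` will do.
-/

noncomputable section

/-! ## Filtration by word length and the Ore condition -/

section WordSpan

variable {ι A : Type*} [Ring A]

section CommRing

variable (K : Type*) [CommRing K] [Algebra K A] (g : ι → A)

/-- The span of the words of length at most `r` in the elements of the tuple `g`. For varying `r`,
these submodules are the standard filtration of the subalgebra generated by `g`. -/
def wordSpan (r : ℕ) : Submodule K A :=
  Submodule.span K ((fun L : List ι => (L.map g).prod) '' {L | L.length ≤ r})

variable {K g}

lemma list_prod_mem_wordSpan {L : List ι} {r : ℕ} (hL : L.length ≤ r) :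
    (L.map g).prod ∈ wordSpan K g r :=
  Submodule.subset_span ⟨L, hL, rfl⟩

lemma wordSpan_le_iff {r : ℕ} {S : Submodule K A} :
    wordSpan K g r ≤ S ↔ ∀ L : List ι, L.length ≤ r → (L.map g).prod ∈ S :=
  Submodule.span_le.trans Set.image_subset_iff

lemma one_mem_wordSpan (r : ℕ) : (1 : A) ∈ wordSpan K g r :=
  list_prod_mem_wordSpan (L := []) (Nat.zero_le r)

lemma self_mem_wordSpan (i : ι) : g i ∈ wordSpan K g 1 := by
  simpa using list_prod_mem_wordSpan (K := K) (g := g) (L := [i]) le_rfl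

lemma wordSpan_mono : Monotone (wordSpan K g) := fun _ _ hrs =>
  Submodule.span_mono (Set.image_mono fun _ hL => le_trans hL hrs)

lemma mul_mem_wordSpan {r s : ℕ} {a b : A} (ha : a ∈ wordSpan K g r) (hb : b ∈ wordSpan K g s) :
    a * b ∈ wordSpan K g (r + s) := by
  have hab := Submodule.mul_mem_mul ha hb
  rw [wordSpan, wordSpan, Submodule.span_mul_span] at hab
  refine Submodule.span_mono ?_ hab
  rintro _ ⟨_, ⟨L, hL, rfl⟩, _, ⟨M, hM, rfl⟩, rfl⟩
  refine ⟨L ++ M, ?_, by simp⟩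
  exact List.length_append.trans_le (Nat.add_le_add hL hM)

lemma self_mul_mem_wordSpan (i : ι) {r : ℕ} {a : A} (ha : a ∈ wordSpan K g r) :
    g i * a ∈ wordSpan K g (r + 1) :=
  Nat.add_comm 1 r ▸ mul_mem_wordSpan (self_mem_wordSpan i) ha

lemma wordSpan_zero : wordSpan K g 0 = 1 := by
  simp [wordSpan, Submodule.one_eq_span]

lemma mul_mem_wordSpan_of_mem_zero {r : ℕ} {c a : A} (hc : c ∈ wordSpan K g 0)
    (ha : a ∈ wordSpan K g r) : c * a ∈ wordSpan K g r :=
  Nat.zero_add r ▸ mul_mem_wordSpan hc ha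

lemma exists_mem_wordSpan (hg : Algebra.adjoin K (Set.range g) = ⊤) (a : A) :
    ∃ r, a ∈ wordSpan K g r := by
  have ha : a ∈ Algebra.adjoin K (Set.range g) := hg ▸ Algebra.mem_top
  induction ha using Algebra.adjoin_induction with
  | mem x hx =>
    obtain ⟨i, rfl⟩ := hx
    exact ⟨1, self_mem_wordSpan i⟩
  | algebraMap c => exact ⟨0, by rw [wordSpan_zero]; exact Submodule.algebraMap_mem c⟩
  | add x y _ _ hx hy =>
    obtain ⟨r, hr⟩ := hx
    obtain ⟨s, hs⟩ := hy
    exact ⟨max r s, add_mem (wordSpan_mono (le_max_left r s) hr)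
      (wordSpan_mono (le_max_right r s) hs)⟩
  | mul x y _ _ hx hy =>
    obtain ⟨r, hr⟩ := hx
    obtain ⟨s, hs⟩ := hy
    exact ⟨r + s, mul_mem_wordSpan hr hs⟩

instance finite_wordSpan [Finite ι] (r : ℕ) : Module.Finite K (wordSpan K g r) :=
  Module.Finite.span_of_finite K ((List.finite_length_le ι r).image _)

end CommRing

section Growth

variable {K : Type*} [Field K] [Algebra K A] {g : ι → A}

lemma two_mul_finrank_wordSpan_le [Finite ι] {a b : A} {d : ℕ}
    (ha : a ∈ wordSpan K g d) (hb : b ∈ wordSpan K g d)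
    (hab : ∀ u v : A, u * a = v * b → u = 0 ∧ v = 0) (r : ℕ) :
    2 * Module.finrank K (wordSpan K g r) ≤ Module.finrank K (wordSpan K g (r + d)) := by
  let W := wordSpan K g r
  let f : W × W →ₗ[K] A :=
    (LinearMap.mulRight K a ∘ₗ W.subtype).coprod (-(LinearMap.mulRight K b ∘ₗ W.subtype))
  have f_apply (u v : W) : f (u, v) = u * a - v * b := by simp [f, sub_eq_add_neg]
  have f_mem (p : W × W) : f p ∈ wordSpan K g (r + d) := by
    rw [f_apply]
    exact sub_mem (mul_mem_wordSpan p.1.2 ha) (mul_mem_wordSpan p.2.2 hb)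
  have f_injective : Function.Injective f := by
    rw [injective_iff_map_eq_zero]
    rintro ⟨u, v⟩ huv
    rw [f_apply, sub_eq_zero] at huv
    obtain ⟨hu, hv⟩ := hab u v huv
    exact Prod.ext (Subtype.ext hu) (Subtype.ext hv)
  have := LinearMap.finrank_le_finrank_of_injective (f := f.codRestrict _ f_mem)
    fun p q hpq => f_injective (congrArg Subtype.val hpq)
  rwa [Module.finrank_prod, ← two_mul] at this

lemma exists_pow_lt_two_pow (d N : ℕ) : ∃ j : ℕ, (j * d + 1) ^ N < 2 ^ j := by
  have htendsto := (tendsto_pow_const_div_const_pow_of_one_lt N (r := (2 : ℝ)) one_lt_two).const_mul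
    ((d + 1 : ℝ) ^ N)
  rw [mul_zero] at htendsto
  obtain ⟨j, hj, hj1⟩ := ((htendsto.eventually (gt_mem_nhds one_pos)).and
    (Filter.eventually_ge_atTop 1)).exists
  rw [← mul_div_assoc, div_lt_one (by positivity), ← mul_pow] at hj
  refine ⟨j, Nat.cast_lt (α := ℝ).mp ?_⟩
  push_cast
  refine lt_of_le_of_lt (pow_le_pow_left₀ (by positivity) ?_ N) hj
  have : (1 : ℝ) ≤ j := by exact_mod_cast hj1
  linarith

theorem exists_left_common_multiple_of_growth [Finite ι] [IsDomain A]
    (hg : Algebra.adjoin K (Set.range g) = ⊤) {N : ℕ}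
    (hN : ∀ r, Module.finrank K (wordSpan K g r) ≤ (r + 1) ^ N) (a b : A) (hb : b ≠ 0) :
    ∃ c d : A, d ≠ 0 ∧ d * a = c * b := by
  by_contra! hcon
  have hab (u v : A) (huv : u * a = v * b) : u = 0 ∧ v = 0 := by
    have hu : u = 0 := by_contra fun hu => hcon v u hu huv
    rw [hu, zero_mul, zero_eq_mul] at huv
    exact ⟨hu, huv.resolve_right hb⟩
  obtain ⟨r, hr⟩ := exists_mem_wordSpan hg a
  obtain ⟨s, hs⟩ := exists_mem_wordSpan hg b
  have hdouble := two_mul_finrank_wordSpan_le (wordSpan_mono (le_max_left r s) hr)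
    (wordSpan_mono (le_max_right r s) hs) hab
  have hpow (j : ℕ) : 2 ^ j ≤ Module.finrank K (wordSpan K g (j * max r s)) := by
    induction j with
    | zero =>
      rw [pow_zero, Nat.one_le_iff_ne_zero, ← Nat.pos_iff_ne_zero,
        Module.finrank_pos_iff_exists_ne_zero]
      exact ⟨⟨1, one_mem_wordSpan _⟩, fun h => one_ne_zero (congrArg Subtype.val h)⟩
    | succ j ih =>
      rw [pow_succ', add_mul, one_mul]
      exact (Nat.mul_le_mul_left 2 ih).trans (hdouble _)
  obtain ⟨j, hj⟩ := exists_pow_lt_two_pow (max r s) N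
  exact hj.not_ge ((hpow j).trans (hN _))

end Growth

/-! ## Almost commuting generators -/

section AlmostCommuting

variable {K : Type*} [CommRing K] [Algebra K A] {g : ι → A}

lemma list_prod_sub_mem_of_perm (hg : ∀ i j, ⁅g i, g j⁆ ∈ wordSpan K g 1) {L M : List ι}
    (hLM : L.Perm M) {r : ℕ} (hr : L.length ≤ r + 1) :
    (L.map g).prod - (M.map g).prod ∈ wordSpan K g r := by
  induction hLM generalizing r with
  | nil => simp
  | @cons i L M hLM ih =>
    rw [List.length_cons, Nat.succ_le_succ_iff] at hr
    simp only [List.map_cons, List.prod_cons, ← mul_sub]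
    obtain _ | r := r
    · obtain rfl := List.eq_nil_of_length_eq_zero (Nat.le_zero.mp hr)
      simp [List.nil_perm.mp hLM]
    · exact self_mul_mem_wordSpan i (ih hr)
  | swap i j L =>
    simp only [List.map_cons, List.prod_cons, ← mul_assoc, ← sub_mul, ← Ring.lie_def]
    have hL : L.length + 1 ≤ r := by simpa using hr
    exact wordSpan_mono (Nat.add_comm 1 _ ▸ hL)
      (mul_mem_wordSpan (hg j i) (list_prod_mem_wordSpan le_rfl))
  | trans hLM _ ih₁ ih₂ =>
    rw [← sub_add_sub_cancel]
    exact add_mem (ih₁ hr) (ih₂ (hLM.length_eq ▸ hr))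

lemma wordSpan_le_span_multiset (hg : ∀ i j, ⁅g i, g j⁆ ∈ wordSpan K g 1) (r : ℕ) :
    wordSpan K g r ≤ Submodule.span K
      ((fun s : Multiset ι => (s.toList.map g).prod) '' {s | s.card ≤ r}) := by
  have mem_span (L : List ι) (r : ℕ) (hL : L.length ≤ r) :
      ((L : Multiset ι).toList.map g).prod ∈ Submodule.span K
        ((fun s : Multiset ι => (s.toList.map g).prod) '' {s | s.card ≤ r}) :=
    Submodule.subset_span ⟨L, hL, rfl⟩
  induction r with
  | zero =>
    refine wordSpan_le_iff.mpr fun L hL => ?_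
    obtain rfl := List.eq_nil_of_length_eq_zero (Nat.le_zero.mp hL)
    simpa only [Multiset.coe_nil, Multiset.toList_zero] using mem_span [] 0 le_rfl
  | succ r ih =>
    refine wordSpan_le_iff.mpr fun L hL => ?_
    have hperm : L.Perm (L : Multiset ι).toList := Multiset.coe_eq_coe.mp (by simp)
    have hlower := ih (list_prod_sub_mem_of_perm hg hperm hL)
    rw [← sub_add_cancel (L.map g).prod ((L : Multiset ι).toList.map g).prod]
    exact add_mem (Submodule.span_mono (Set.image_mono fun _ hs => Nat.le_succ_of_le hs) hlower)
      (mem_span L (r + 1) hL)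

lemma finrank_wordSpan_le [Nontrivial K] [Fintype ι] (hg : ∀ i j, ⁅g i, g j⁆ ∈ wordSpan K g 1)
    (r : ℕ) : Module.finrank K (wordSpan K g r) ≤ (r + 1) ^ Fintype.card ι := by
  classical
  let monomial (e : ι → Fin (r + 1)) : A := ((∑ i, (e i : ℕ) • {i} : Multiset ι).toList.map g).prod
  have hle : wordSpan K g r ≤ Submodule.span K (Set.range monomial) := by
    refine (wordSpan_le_span_multiset hg r).trans (Submodule.span_mono ?_)
    rintro _ ⟨s, hs, rfl⟩
    have hcount (i : ι) : s.count i < r + 1 :=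
      Nat.lt_succ_of_le ((Multiset.count_le_card i s).trans hs)
    refine ⟨fun i => ⟨s.count i, hcount i⟩, ?_⟩
    have hsum : ∑ i, s.count i • {i} = s := Multiset.ext.mpr fun j => by
      simp [Multiset.count_sum', Multiset.count_singleton]
    simp only [monomial, hsum]
  have := Module.Finite.span_of_finite K (Set.finite_range monomial)
  calc Module.finrank K (wordSpan K g r)
      ≤ (Set.range monomial).finrank K := Submodule.finrank_mono hle
    _ ≤ Fintype.card (ι → Fin (r + 1)) := finrank_range_le_card _
    _ = (r + 1) ^ Fintype.card ι := by simp

end AlmostCommuting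

end WordSpan

/-! ## Weyl tuples -/

section IsWeylTuple

/-- A tuple `x_1, …, x_n, y_1, …, y_n` (in this order) that satisfies the relations of the Weyl
algebra. As `⁅y_i, x_i⁆ = 1`, its matrix of commutators is Mathlib's symplectic matrix `J`. -/
def IsWeylTuple {A : Type*} [Ring A] {n : ℕ} (g : Fin n ⊕ Fin n → A) : Prop :=
  ∀ i j, ⁅g i, g j⁆ = ((Matrix.J (Fin n) ℤ i j : ℤ) : A)

variable {ι A : Type*} [Ring A]

attribute [local instance] LieRing.ofAssociativeRing LieAlgebra.ofAssociativeAlgebra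

lemma lie_mul_eq_add (a b c : A) : ⁅a, b * c⁆ = ⁅a, b⁆ * c + b * ⁅a, c⁆ := by
  simp only [Ring.lie_def]
  noncomm_ring

lemma lie_mem_wordSpan {K : Type*} [CommRing K] [Algebra K A] {g : ι → A} {y : A}
    (hy : ∀ j, ⁅y, g j⁆ ∈ wordSpan K g 0) {r : ℕ} {a : A} (ha : a ∈ wordSpan K g (r + 1)) :
    ⁅y, a⁆ ∈ wordSpan K g r := by
  have lie_word (L : List ι) (r : ℕ) (hL : L.length ≤ r + 1) :
      ⁅y, (L.map g).prod⁆ ∈ wordSpan K g r := by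
    induction L generalizing r with
    | nil => simp [Ring.lie_def]
    | cons j L ih =>
      rw [List.length_cons, Nat.succ_le_succ_iff] at hL
      rw [List.map_cons, List.prod_cons, lie_mul_eq_add]
      refine add_mem (mul_mem_wordSpan_of_mem_zero (hy j) (list_prod_mem_wordSpan hL)) ?_
      obtain _ | r := r
      · simp [List.eq_nil_of_length_eq_zero (Nat.le_zero.mp hL), Ring.lie_def]
      · exact self_mul_mem_wordSpan j (ih r hL)
  suffices h : wordSpan K g (r + 1) ≤ (wordSpan K g r).comap (LieAlgebra.ad K A y) from h ha
  exact wordSpan_le_iff.mpr fun L hL => lie_word L r hL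

section Euler

variable {K : Type*} [CommRing K] [Algebra K A] [Fintype ι] {g d : ι → A}

variable (K g d) in
/-- The Euler operator `a ↦ ∑ i, g i * ⁅d i, a⁆`. When `d` is dual to `g` under the commutator, it
multiplies the words of length `r` by `r`, up to shorter words. -/
def eulerOperator : A →ₗ[K] A :=
  ∑ i, LinearMap.mulLeft K (g i) ∘ₗ (LieAlgebra.ad K A (d i) : A →ₗ[K] A)

lemma eulerOperator_apply (a : A) : eulerOperator K g d a = ∑ i, g i * ⁅d i, a⁆ := by
  simp [eulerOperator]

lemma eulerOperator_self_mul [DecidableEq ι] (hd : ∀ i j, ⁅d i, g j⁆ = if i = j then 1 else 0)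
    (j : ι) (a : A) : eulerOperator K g d (g j * a) =
      g j * a + g j * eulerOperator K g d a + ∑ i, ⁅g i, g j⁆ * ⁅d i, a⁆ := by
  have hswap (i : ι) : g i * (g j * ⁅d i, a⁆) = g j * (g i * ⁅d i, a⁆) + ⁅g i, g j⁆ * ⁅d i, a⁆ := by
    simp only [Ring.lie_def, sub_mul, mul_assoc]
    abel
  simp [eulerOperator_apply, lie_mul_eq_add, hd, mul_add, hswap, Finset.sum_add_distrib,
    Finset.mul_sum, add_assoc]

lemma eulerOperator_sub_mem_wordSpan [DecidableEq ι]
    (hg : ∀ i j, ⁅g i, g j⁆ ∈ wordSpan K g 0) (hd : ∀ i j, ⁅d i, g j⁆ = if i = j then 1 else 0)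
    {r : ℕ} {a : A} (ha : a ∈ wordSpan K g (r + 1)) :
    eulerOperator K g d a - (r + 1) • a ∈ wordSpan K g r := by
  have hd0 (i j : ι) : ⁅d i, g j⁆ ∈ wordSpan K g 0 := by
    rw [hd]
    split_ifs
    exacts [one_mem_wordSpan 0, zero_mem _]
  have euler_word (L : List ι) (r : ℕ) (hL : L.length ≤ r + 1) :
      eulerOperator K g d (L.map g).prod - (r + 1) • (L.map g).prod ∈ wordSpan K g r := by
    induction L generalizing r with
    | nil =>
      have hone : eulerOperator K g d 1 = 0 := by simp [eulerOperator_apply, Ring.lie_def]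
      rw [List.map_nil, List.prod_nil, hone, zero_sub]
      exact neg_mem (nsmul_mem (one_mem_wordSpan r) (r + 1))
    | cons j L ih =>
      rw [List.length_cons, Nat.succ_le_succ_iff] at hL
      rw [List.map_cons, List.prod_cons, eulerOperator_self_mul hd]
      obtain _ | r := r
      · simp [List.eq_nil_of_length_eq_zero (Nat.le_zero.mp hL), eulerOperator_apply, Ring.lie_def]
      · have hL' := list_prod_mem_wordSpan (K := K) (g := g) hL
        have hlie : ∑ i, ⁅g i, g j⁆ * ⁅d i, (L.map g).prod⁆ ∈ wordSpan K g r :=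
          sum_mem fun i _ => mul_mem_wordSpan_of_mem_zero (hg i j) (lie_mem_wordSpan (hd0 i) hL')
        convert add_mem (self_mul_mem_wordSpan j (ih r hL)) (wordSpan_mono r.le_succ hlie) using 1
        rw [mul_sub, mul_smul_comm]
        module
  suffices h : wordSpan K g (r + 1) ≤ (wordSpan K g r).comap
    (eulerOperator K g d - (r + 1) • LinearMap.id) from h ha
  exact wordSpan_le_iff.mpr fun L hL => euler_word L r hL

end Euler

namespace IsWeylTuple

variable {n : ℕ} {g : Fin n ⊕ Fin n → A}

/-- The tuple `y_1, …, y_n, -x_1, …, -x_n`, which is dual to the Weyl tuple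
`x_1, …, x_n, y_1, …, y_n` under the commutator. -/
def dual (g : Fin n ⊕ Fin n → A) : Fin n ⊕ Fin n → A :=
  Sum.elim (fun i => g (Sum.inr i)) (fun i => -g (Sum.inl i))

lemma lie_dual (hg : IsWeylTuple g) (i j : Fin n ⊕ Fin n) :
    ⁅dual g i, g j⁆ = if i = j then 1 else 0 := by
  rcases i with i | i <;> rcases j with j | j <;>
    simp [dual, hg _ _, Matrix.J, Matrix.one_apply]

lemma lie_mem_wordSpan_zero (K : Type*) [CommRing K] [Algebra K A] (hg : IsWeylTuple g)
    (i j : Fin n ⊕ Fin n) : ⁅g i, g j⁆ ∈ wordSpan K g 0 := by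
  rw [hg, wordSpan_zero, ← map_intCast (algebraMap K A)]
  exact Submodule.algebraMap_mem _

theorem injective_of_adjoin_eq_top {K : Type*} [Field K] [CharZero K] [Algebra K A]
    (hg : IsWeylTuple g) (htop : Algebra.adjoin K (Set.range g) = ⊤) {D : Type*} [Ring D]
    [Nontrivial D] [Algebra K D] (f : A →ₐ[K] D) : Function.Injective f := by
  rw [injective_iff_map_eq_zero]
  intro a hfa
  obtain ⟨r, ha⟩ := exists_mem_wordSpan htop a
  induction r generalizing a with
  | zero =>
    rw [wordSpan_zero, Submodule.mem_one] at ha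
    obtain ⟨c, rfl⟩ := ha
    rw [AlgHom.commutes, FaithfulSMul.algebraMap_eq_zero_iff] at hfa
    rw [hfa, map_zero]
  | succ r ih =>
    have hdual (i : Fin n ⊕ Fin n) : ⁅dual g i, a⁆ = 0 := by
      refine ih _ (by simp [Ring.lie_def, hfa]) (lie_mem_wordSpan (fun j => ?_) ha)
      rw [hg.lie_dual]
      split_ifs
      exacts [one_mem_wordSpan 0, zero_mem _]
    have heuler := eulerOperator_sub_mem_wordSpan (hg.lie_mem_wordSpan_zero K) hg.lie_dual ha
    simp only [eulerOperator_apply, hdual, mul_zero, Finset.sum_const_zero, zero_sub,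
      neg_mem_iff, ← Nat.cast_smul_eq_nsmul K] at heuler
    exact ih a hfa ((Submodule.smul_mem_iff _ (Nat.cast_ne_zero.mpr r.succ_ne_zero)).mp heuler)

theorem exists_left_common_multiple {K : Type*} [Field K] [Algebra K A] [IsDomain A]
    (hg : IsWeylTuple g) (htop : Algebra.adjoin K (Set.range g) = ⊤) (a b : A) (hb : b ≠ 0) :
    ∃ c d : A, d ≠ 0 ∧ d * a = c * b :=
  exists_left_common_multiple_of_growth htop (finrank_wordSpan_le fun i j =>
    wordSpan_mono zero_le_one (hg.lie_mem_wordSpan_zero K i j)) a b hb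

end IsWeylTuple

end IsWeylTuple

/-! ## Left fractions and skew fields of fractions -/

/-- The division subring of the elements `q⁻¹ * p`, with `p` and `q` in a subring that satisfies the
left Ore condition. -/
def leftFractionSubfield {D : Type*} [DivisionRing D] (S : Subring D)
    (hS : ∀ a ∈ S, ∀ b ∈ S, b ≠ 0 → ∃ c ∈ S, ∃ d ∈ S, d ≠ 0 ∧ d * a = c * b) : Subfield D where
  carrier := {x | ∃ p ∈ S, ∃ q ∈ S, q ≠ 0 ∧ q * x = p}
  one_mem' := ⟨1, S.one_mem, 1, S.one_mem, one_ne_zero, one_mul 1⟩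
  zero_mem' := ⟨0, S.zero_mem, 1, S.one_mem, one_ne_zero, mul_zero 1⟩
  neg_mem' := by
    rintro x ⟨p, hp, q, hq, hq0, h⟩
    exact ⟨-p, S.neg_mem hp, q, hq, hq0, by rw [mul_neg, h]⟩
  mul_mem' := by
    rintro x y ⟨p, hp, q, hq, hq0, rfl⟩ ⟨p₁, hp₁, q₁, hq₁, hq₁0, rfl⟩
    obtain ⟨c, hc, d, hd, hd0, h⟩ := hS _ hp _ hq₁ hq₁0
    refine ⟨c * (q₁ * y), S.mul_mem hc hp₁, d * q, S.mul_mem hd hq, mul_ne_zero hd0 hq0, ?_⟩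
    rw [← mul_assoc c, ← h]
    simp only [mul_assoc]
  add_mem' := by
    rintro x y ⟨p, hp, q, hq, hq0, rfl⟩ ⟨p₁, hp₁, q₁, hq₁, hq₁0, rfl⟩
    obtain ⟨c, hc, d, hd, hd0, h⟩ := hS _ hq _ hq₁ hq₁0
    refine ⟨d * (q * x) + c * (q₁ * y), S.add_mem (S.mul_mem hd hp) (S.mul_mem hc hp₁), d * q,
      S.mul_mem hd hq, mul_ne_zero hd0 hq0, ?_⟩
    rw [← mul_assoc c, ← h, ← mul_assoc, mul_add]
  inv_mem' := by
    rintro x ⟨p, hp, q, hq, hq0, rfl⟩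
    obtain rfl | hx := eq_or_ne x 0
    · exact ⟨0, S.zero_mem, 1, S.one_mem, one_ne_zero, by simp⟩
    · exact ⟨q, hq, q * x, hp, mul_ne_zero hq0 hx, by rw [mul_assoc, mul_inv_cancel₀ hx, mul_one]⟩

namespace SkewFrac

variable {A : Type*} [Ring A] [IsOreDomain A]

lemma isUnit_of {a : A} (ha : a ≠ 0) : IsUnit (SkewFrac.of A a) :=
  OreLocalization.numerator_isUnit (⟨a, mem_nonZeroDivisors_of_ne_zero ha⟩ : A⁰)

variable (A) in
lemma isSkewFieldOfFractions_of : IsSkewFieldOfFractions (SkewFrac.of A) where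
  injective := (injective_iff_map_eq_zero _).mpr fun _ h =>
    by_contra fun ha => (isUnit_of ha).ne_zero h
  exists_frac d := by
    induction d using OreLocalization.ind with
    | _ a b =>
      refine ⟨a, b, nonZeroDivisors.coe_ne_zero b, ?_⟩
      rw [eq_inv_mul_iff_mul_eq₀ (isUnit_of (nonZeroDivisors.coe_ne_zero b)).ne_zero]
      exact OreLocalization.mul_cancel

lemma exists_lift {T : Type*} [Ring T] (f : A →+* T) (hf : ∀ a, a ≠ 0 → IsUnit (f a)) :
    ∃ F : SkewFrac A →+* T, ∀ a, F (SkewFrac.of A a) = f a := by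
  let fS : A⁰ →* Tˣ := IsUnit.liftRight ((f : A →* T).comp A⁰.subtype)
    fun s => hf s (nonZeroDivisors.coe_ne_zero s)
  exact ⟨OreLocalization.universalHom f fS fun s => rfl,
    fun a => OreLocalization.universalHom_commutes f fS _⟩

end SkewFrac

lemma IsSkewFieldOfFractions.mem_subfield {A D : Type*} [Ring A] [DivisionRing D] {f : A →+* D}
    (hf : IsSkewFieldOfFractions f) {L : Subfield D} (hL : ∀ a, f a ∈ L) (d : D) : d ∈ L := by
  obtain ⟨a, b, -, rfl⟩ := hf.exists_frac d
  exact L.mul_mem (L.inv_mem (hL b)) (hL a)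

/-! ## Reduced products -/

section ReducedProduct

variable {Φ : Type*} (l : Filter Φ) (D : Φ → Type*)

/-- The ideal, of a product of rings, of the elements whose components vanish eventually along the
filter `l`. -/
def eventuallyZero [∀ φ, Ring (D φ)] : Ideal (∀ φ, D φ) where
  carrier := {f | ∀ᶠ φ in l, f φ = 0}
  zero_mem' := Filter.Eventually.of_forall fun _ => rfl
  add_mem' hf hg := by
    filter_upwards [hf, hg] with φ hfφ hgφ
    rw [Pi.add_apply, hfφ, hgφ, add_zero]
  smul_mem' c f hf := by
    filter_upwards [hf] with φ hfφ
    rw [smul_eq_mul, Pi.mul_apply, hfφ, mul_zero]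

instance [∀ φ, Ring (D φ)] : (eventuallyZero l D).IsTwoSided where
  mul_mem_of_left {f} g hf := by
    filter_upwards [show ∀ᶠ φ in l, f φ = 0 from hf] with φ hfφ
    rw [Pi.mul_apply, hfφ, zero_mul]

/-- The reduced product of the rings `D φ` along the filter `l`: a version of `Filter.Product` that
carries a ring structure. -/
abbrev ReducedProduct [∀ φ, Ring (D φ)] : Type _ := (∀ φ, D φ) ⧸ eventuallyZero l D

variable {l D}

namespace ReducedProduct

section Ring

variable [∀ φ, Ring (D φ)]

/-- The quotient map onto the reduced product. -/
abbrev mk : (∀ φ, D φ) →+* ReducedProduct l D := Ideal.Quotient.mk _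

lemma mk_eq_mk_iff {f g : ∀ φ, D φ} :
    (mk f : ReducedProduct l D) = mk g ↔ ∀ᶠ φ in l, f φ = g φ := by
  rw [Ideal.Quotient.eq]
  exact Filter.eventually_congr (Filter.Eventually.of_forall fun φ => sub_eq_zero)

/-- A chosen representative of an element of the reduced product. Every ring identity between
elements holds eventually for the components of their representatives. -/
def rep (a : ReducedProduct l D) : ∀ φ, D φ := Function.surjInv Ideal.Quotient.mk_surjective a

@[simp]
lemma mk_rep (a : ReducedProduct l D) : mk a.rep = a := Function.surjInv_eq _ a

lemma eventually_rep_eq_of_eq_mk {a : ReducedProduct l D} {f : ∀ φ, D φ} (h : a = mk f) :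
    ∀ᶠ φ in l, a.rep φ = f φ :=
  mk_eq_mk_iff.mp ((mk_rep a).trans h)

lemma eventually_rep_add (a b : ReducedProduct l D) :
    ∀ᶠ φ in l, (a + b).rep φ = a.rep φ + b.rep φ :=
  eventually_rep_eq_of_eq_mk (f := a.rep + b.rep) (by simp)

lemma eventually_rep_mul (a b : ReducedProduct l D) :
    ∀ᶠ φ in l, (a * b).rep φ = a.rep φ * b.rep φ :=
  eventually_rep_eq_of_eq_mk (f := a.rep * b.rep) (by simp)

lemma eventually_rep_lie (a b : ReducedProduct l D) :
    ∀ᶠ φ in l, ⁅a, b⁆.rep φ = ⁅a.rep φ, b.rep φ⁆ :=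
  eventually_rep_eq_of_eq_mk (f := a.rep * b.rep - b.rep * a.rep) (by simp [Ring.lie_def])

lemma eventually_rep_intCast (n : ℤ) :
    ∀ᶠ φ in l, (n : ReducedProduct l D).rep φ = n :=
  eventually_rep_eq_of_eq_mk (map_intCast mk n).symm

lemma eventually_rep_sum_mul_pow {m : ℕ} (f : Fin m → ReducedProduct l D)
    (c : ReducedProduct l D) :
    ∀ᶠ φ in l, (∑ j, f j * c ^ (j : ℕ)).rep φ = ∑ j, (f j).rep φ * c.rep φ ^ (j : ℕ) := by
  filter_upwards [eventually_rep_eq_of_eq_mk (a := ∑ j, f j * c ^ (j : ℕ))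
    (f := ∑ j, (f j).rep * c.rep ^ (j : ℕ)) (by simp)] with φ hφ
  simpa using hφ

end Ring

lemma isUnit_mk_iff [∀ φ, DivisionRing (D φ)] {f : ∀ φ, D φ} :
    IsUnit (mk f : ReducedProduct l D) ↔ ∀ᶠ φ in l, f φ ≠ 0 := by
  constructor
  · intro hf
    obtain ⟨g, hg⟩ := hf.exists_right_inv
    obtain ⟨g, rfl⟩ := Ideal.Quotient.mk_surjective g
    rw [← map_mul, ← map_one mk, mk_eq_mk_iff] at hg
    filter_upwards [hg] with φ hφ
    exact left_ne_zero_of_mul_eq_one hφ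
  · intro hf
    refine isUnit_iff_exists.mpr ⟨mk fun φ => (f φ)⁻¹, ?_, ?_⟩ <;>
      rw [← map_mul, ← map_one mk, mk_eq_mk_iff]
    · filter_upwards [hf] with φ hφ
      exact mul_inv_cancel₀ hφ
    · filter_upwards [hf] with φ hφ
      exact inv_mul_cancel₀ hφ

lemma eventually_rep_ne_zero [∀ φ, DivisionRing (D φ)] {a : ReducedProduct l D} (ha : IsUnit a) :
    ∀ᶠ φ in l, a.rep φ ≠ 0 :=
  isUnit_mk_iff.mp ((mk_rep a).symm ▸ ha)

end ReducedProduct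

end ReducedProduct

/-! ## Generic geometric points -/

section GeometricPoint

lemma exists_linearIndependent_smul_eq_sum {R M ι : Type*} [CommRing R] [IsDomain R]
    [AddCommGroup M] [Module R M] [Finite ι] (v : ι → M) :
    ∃ (t : Finset ι) (N : R) (c : ι → t → R), LinearIndependent R (fun j : t => v j) ∧ N ≠ 0 ∧
      ∀ i, N • v i = ∑ j, c i j • v j := by
  classical
  have := Fintype.ofFinite ι
  obtain ⟨t, ht, hspan⟩ := exists_maximal_linearIndepOn R v
  have hspan' (i : ι) : ∃ a : R, a ≠ 0 ∧ a • v i ∈ Submodule.span R (v '' t) := by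
    by_cases hi : i ∈ t
    · exact ⟨1, one_ne_zero, by
        simpa using Submodule.subset_span (R := R) (Set.mem_image_of_mem v hi)⟩
    · exact hspan i hi
  choose a ha0 ha using hspan'
  have hN (i : ι) : (∏ i, a i) • v i ∈ Submodule.span R (Set.range fun j : t.toFinset => v j) := by
    have hrange : (Set.range fun j : t.toFinset => v j) = v '' t := by
      ext
      simp
    rw [hrange, ← Finset.prod_erase_mul _ _ (Finset.mem_univ i), mul_smul]
    exact Submodule.smul_mem _ _ (ha i)
  choose c hc using fun i => (Submodule.mem_span_range_iff_exists_fun R).mp (hN i)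
  refine ⟨t.toFinset, ∏ i, a i, c, ?_, Finset.prod_ne_zero_iff.mpr fun i _ => ha0 i,
    fun i => (hc i).symm⟩
  exact ht.linearIndependent.comp (fun j : t.toFinset => (⟨j, Set.mem_toFinset.mp j.2⟩ : t))
    fun _ _ hij => Subtype.ext (congrArg (fun j : t => j.1) hij)

lemma exists_finset_forall_rTensor_eq_zero_iff {P M : Type*} [AddCommGroup P] [AddCommGroup M]
    (x : P ⊗[ℤ] M) : ∃ s : Finset P, ∀ (k : Type u) [Field k] [CharZero k] (φ : P →ₗ[ℤ] k),
      φ.rTensor M x = 0 ↔ ∀ p ∈ s, φ p = 0 := by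
  classical
  obtain ⟨S, rfl⟩ := TensorProduct.exists_finset x
  obtain ⟨t, N, c, ht, hN, hc⟩ := exists_linearIndependent_smul_eq_sum (R := ℤ) fun i : S => i.1.2
  refine ⟨Finset.univ.image fun j : t => ∑ i : S, c i j • i.1.1, fun k _ _ φ => ?_⟩
  have hφx : N • φ.rTensor M (∑ i ∈ S, i.1 ⊗ₜ i.2) =
      ∑ j : t, φ (∑ i : S, c i j • i.1.1) • (1 : k) ⊗ₜ[ℤ] j.1.1.2 := by
    calc N • φ.rTensor M (∑ i ∈ S, i.1 ⊗ₜ i.2)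
        = ∑ i : S, φ i.1.1 ⊗ₜ (N • i.1.2) := by
          rw [← Finset.sum_coe_sort S, map_sum, Finset.smul_sum]
          exact Finset.sum_congr rfl fun i _ => (TensorProduct.tmul_smul N _ _).symm
      _ = ∑ i : S, ∑ j : t, φ (c i j • i.1.1) ⊗ₜ j.1.1.2 := by
          simp only [hc, TensorProduct.tmul_sum, map_smul, TensorProduct.smul_tmul]
      _ = ∑ j : t, φ (∑ i : S, c i j • i.1.1) • (1 : k) ⊗ₜ[ℤ] j.1.1.2 := by
          rw [Finset.sum_comm]
          simp only [map_sum, Finset.sum_smul, TensorProduct.smul_tmul', smul_eq_mul, mul_one]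
  have hN' : (N : k) ≠ 0 := Int.cast_ne_zero.mpr hN
  have hlin : LinearIndependent k fun j : t => (1 : k) ⊗ₜ[ℤ] j.1.1.2 :=
    Module.Flat.linearIndependent_one_tmul ht
  rw [← smul_eq_zero_iff_right hN', Int.cast_smul_eq_zsmul, hφx]
  simp only [Finset.forall_mem_image, Finset.mem_univ, true_implies]
  exact ⟨Fintype.linearIndependent_iff.mp hlin _, fun h => Finset.sum_eq_zero fun j _ => by
    rw [h, zero_smul]⟩

/-- A ring homomorphism from `P` to an algebraically closed field of characteristic zero. -/
structure GeometricPoint (P : Type*) [CommRing P] where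
  /-- The residue field. -/
  k : Type u
  [field : Field k]
  [isAlgClosed : IsAlgClosed k]
  [charZero : CharZero k]
  /-- The evaluation at the point. -/
  toAlgHom : P →ₐ[ℤ] k

namespace GeometricPoint

attribute [instance] field isAlgClosed charZero

variable {P : Type*} [CommRing P] {k₀ : Type u} [Field k₀] (η : P →ₐ[ℤ] k₀)

/-- The filter of the geometric points that approach the point `η`: any given element of `P`
eventually vanishes at a point if and only if it vanishes at `η`. -/
def generic : Filter (GeometricPoint.{u} P) :=
  ⨅ p : P, Filter.principal {φ | φ.toAlgHom p = 0 ↔ η p = 0}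

lemma eventually_generic (p : P) : ∀ᶠ φ in generic η, φ.toAlgHom p = 0 ↔ η p = 0 :=
  Filter.mem_iInf_of_mem p (Filter.mem_principal_self _)

/-- The base change to `R` of the evaluation at a geometric point. -/
def baseChange (φ : GeometricPoint.{u} P) (R : Type v) [Ring R] : P ⊗[ℤ] R →ₐ[ℤ] φ.k ⊗[ℤ] R :=
  Algebra.TensorProduct.map φ.toAlgHom (AlgHom.id ℤ R)

lemma eventually_baseChange_eq_zero_iff [CharZero k₀] {R : Type v} [Ring R] (x : P ⊗[ℤ] R) :
    ∀ᶠ φ in generic η, φ.baseChange R x = 0 ↔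
      Algebra.TensorProduct.map η (AlgHom.id ℤ R) x = 0 := by
  obtain ⟨s, hs⟩ := exists_finset_forall_rTensor_eq_zero_iff.{u} x
  filter_upwards [(Filter.eventually_all_finset s).mpr fun p _ => eventually_generic η p] with φ hφ
  exact (hs φ.k φ.toAlgHom.toLinearMap).trans
    ((forall₂_congr hφ).trans (hs k₀ η.toLinearMap).symm)

end GeometricPoint

end GeometricPoint

/-! ## Spreading out elements of the skew field of fractions -/

section Spreading

lemma SkewFrac.exists_hom_reducedProduct {A' A Φ : Type*} [Ring A'] [Ring A] [IsOreDomain A]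
    {l : Filter Φ} {D : Φ → Type*} [∀ φ, DivisionRing (D φ)] (π : A' →+* A)
    (hπ : Function.Surjective π) (ψ : ∀ φ, A' →+* D φ)
    (hψ : ∀ u, ∀ᶠ φ in l, ψ φ u = 0 ↔ π u = 0) :
    ∃ Θ : SkewFrac A →+* ReducedProduct l D,
      ∀ u, Θ (SkewFrac.of A (π u)) = ReducedProduct.mk fun φ => ψ φ u := by
  let Ψ : A' →+* ReducedProduct l D := ReducedProduct.mk.comp (RingHom.pi ψ)
  have hker : RingHom.ker π ≤ RingHom.ker Ψ := fun u hu =>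
    Ideal.Quotient.eq_zero_iff_mem.mpr <| (hψ u).mono fun φ hφ => hφ.mpr hu
  let f : A →+* ReducedProduct l D :=
    π.liftOfRightInverse _ (Function.rightInverse_surjInv hπ) ⟨Ψ, hker⟩
  have hf (u : A') : f (π u) = Ψ u := π.liftOfRightInverse_comp_apply _ _ ⟨Ψ, hker⟩ u
  obtain ⟨Θ, hΘ⟩ := SkewFrac.exists_lift f fun a ha => by
    obtain ⟨u, rfl⟩ := hπ a
    exact hf u ▸ ReducedProduct.isUnit_mk_iff.mpr ((hψ u).mono fun φ hφ => mt hφ.mp ha)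
  exact ⟨Θ, fun u => (hΘ _).trans (hf u)⟩

/-- `R` is an Ore domain after base change to any algebraically closed field of characteristic
zero. -/
class IsGeometricallyOre (R : Type v) [Ring R] : Prop where
  isOreDomain : ∀ (k : Type u) [Field k] [IsAlgClosed k] [CharZero k], IsOreDomain (k ⊗[ℤ] R)

attribute [instance] IsGeometricallyOre.isOreDomain

variable {R : Type v} [Ring R] [IsGeometricallyOre.{u} R] {P : Type*} [CommRing P]
  {k₀ : Type u} [Field k₀] [IsAlgClosed k₀] [CharZero k₀] {η : P →ₐ[ℤ] k₀}

variable (R) in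
lemma GeometricPoint.exists_hom_reducedProduct (hη : Function.Surjective η) :
    ∃ Θ : SkewFrac (k₀ ⊗[ℤ] R) →+*
        ReducedProduct (generic.{u} η) fun φ => SkewFrac (φ.k ⊗[ℤ] R),
      ∀ x, Θ (SkewFrac.of _ (Algebra.TensorProduct.map η (AlgHom.id ℤ R) x)) =
        ReducedProduct.mk fun φ => SkewFrac.of _ (φ.baseChange R x) := by
  refine SkewFrac.exists_hom_reducedProduct
    (Algebra.TensorProduct.map η (AlgHom.id ℤ R) : P ⊗[ℤ] R →+* k₀ ⊗[ℤ] R)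
    (TensorProduct.map_surjective hη Function.surjective_id)
    (fun φ : GeometricPoint P => (SkewFrac.of _).comp (φ.baseChange R : P ⊗[ℤ] R →+* φ.k ⊗[ℤ] R))
    fun x => ?_
  filter_upwards [eventually_baseChange_eq_zero_iff η x] with φ hφ
  exact (map_eq_zero_iff _ (SkewFrac.isSkewFieldOfFractions_of _).injective).trans hφ

end Spreading

/-! ## Weyl algebras -/

namespace WeylAlgebra

variable {n : ℕ} {K : Type*}

section CommRing

variable [CommRing K]

/-- The generators of the Weyl algebra, `x_i` at `Sum.inl i` and `y_i` at `Sum.inr i`. -/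
def gen (i : Fin n ⊕ Fin n) : WeylAlgebra n K :=
  RingQuot.mkAlgHom K (WeylRel n K) (FreeAlgebra.ι K i)

lemma isWeylTuple_gen : IsWeylTuple (gen : Fin n ⊕ Fin n → WeylAlgebra n K) := by
  have hxx (i j : Fin n) := RingQuot.mkAlgHom_rel K (WeylRel.xx (K := K) i j)
  have hyy (i j : Fin n) := RingQuot.mkAlgHom_rel K (WeylRel.yy (K := K) i j)
  have hyx (i j : Fin n) := RingQuot.mkAlgHom_rel K (WeylRel.yx (K := K) i j)
  simp only [map_mul, map_add, apply_ite (RingQuot.mkAlgHom K (WeylRel n K)), map_one,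
    map_zero] at hxx hyy hyx
  rintro (i | i) (j | j) <;> rw [Ring.lie_def, gen, gen]
  · simp [Matrix.J, hxx i j]
  · obtain rfl | hij := eq_or_ne i j
    · simp [Matrix.J, hyx]
    · simp [Matrix.J, hyx, hij, hij.symm]
  · simp [Matrix.J, hyx i j, Matrix.one_apply]
  · simp [Matrix.J, hyy i j]

lemma adjoin_gen : Algebra.adjoin K (Set.range (gen : Fin n ⊕ Fin n → WeylAlgebra n K)) = ⊤ := by
  have hrange : Set.range (gen : Fin n ⊕ Fin n → WeylAlgebra n K) =
      RingQuot.mkAlgHom K (WeylRel n K) '' Set.range (FreeAlgebra.ι K) := Set.range_comp _ _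
  rw [hrange, ← AlgHom.map_adjoin, FreeAlgebra.adjoin_range_ι, Algebra.map_top,
    AlgHom.range_eq_top]
  exact RingQuot.mkAlgHom_surjective K (WeylRel n K)

/-- The homomorphism out of the Weyl algebra that is given by a Weyl tuple. -/
def lift {D : Type*} [Ring D] [Algebra K D] {w : Fin n ⊕ Fin n → D} (hw : IsWeylTuple w) :
    WeylAlgebra n K →ₐ[K] D :=
  RingQuot.liftAlgHom K ⟨FreeAlgebra.lift K w, by
    intro a b h
    induction h with
    | xx i j => simpa [Ring.lie_def, Matrix.J, sub_eq_zero] using hw (Sum.inl i) (Sum.inl j)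
    | yy i j => simpa [Ring.lie_def, Matrix.J, sub_eq_zero] using hw (Sum.inr i) (Sum.inr j)
    | yx i j =>
      have h := hw (Sum.inr i) (Sum.inl j)
      rw [Ring.lie_def, sub_eq_iff_eq_add'] at h
      split_ifs with hij <;> simpa [Matrix.J, Matrix.one_apply, hij] using h⟩

@[simp]
lemma lift_gen {D : Type*} [Ring D] [Algebra K D] {w : Fin n ⊕ Fin n → D} (hw : IsWeylTuple w)
    (i : Fin n ⊕ Fin n) : lift (K := K) hw (gen i) = w i := by
  simp [lift, gen]

end CommRing

theorem isSkewFieldOfFractions_lift [Field K] [CharZero K] {D : Type*} [DivisionRing D]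
    [Algebra K D] {w : Fin n ⊕ Fin n → D} (hw : IsWeylTuple w)
    (hgen : Subfield.closure (Set.range (algebraMap K D) ∪ Set.range w) = ⊤) :
    IsSkewFieldOfFractions (lift (K := K) hw : WeylAlgebra n K →+* D) := by
  have hinj := isWeylTuple_gen.injective_of_adjoin_eq_top adjoin_gen (lift (K := K) hw)
  have : IsDomain (WeylAlgebra n K) := hinj.isDomain (lift hw).toRingHom
  let S := (lift (K := K) hw).toRingHom.range
  have hS : ∀ a ∈ S, ∀ b ∈ S, b ≠ 0 → ∃ c ∈ S, ∃ d ∈ S, d ≠ 0 ∧ d * a = c * b := by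
    rintro _ ⟨a, rfl⟩ _ ⟨b, rfl⟩ hb
    obtain ⟨c, d, hd, hcd⟩ := isWeylTuple_gen.exists_left_common_multiple
      (K := K) adjoin_gen a b (ne_zero_of_map hb)
    exact ⟨_, ⟨c, rfl⟩, _, ⟨d, rfl⟩, (map_ne_zero_iff _ hinj).mpr hd, by simp only [← map_mul, hcd]⟩
  have hle : S ≤ (leftFractionSubfield S hS).toSubring := fun x hx =>
    ⟨x, hx, 1, S.one_mem, one_ne_zero, one_mul x⟩
  have htop : (⊤ : Subfield D) ≤ leftFractionSubfield S hS := by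
    rw [← hgen, Subfield.closure_le]
    rintro _ (⟨a, rfl⟩ | ⟨i, rfl⟩)
    · exact hle ⟨algebraMap K _ a, (lift hw).commutes a⟩
    · exact hle ⟨gen i, lift_gen hw i⟩
  refine ⟨hinj, fun d => ?_⟩
  obtain ⟨_, ⟨a, rfl⟩, _, ⟨b, rfl⟩, hb, h⟩ := htop (Subfield.mem_top d)
  exact ⟨a, b, ne_zero_of_map hb, (eq_inv_mul_iff_mul_eq₀ hb).mpr h⟩

end WeylAlgebra

/-! ## Algebraic dependence -/

section Algebraic

lemma isAlgebraic_iff_exists_sum_smul_pow {A B : Type*} [CommRing A] [Ring B] [Algebra A B]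
    {b : B} :
    IsAlgebraic A b ↔
      ∃ (m : ℕ) (a : Fin m → A), a ≠ 0 ∧ ∑ j, a j • b ^ (j : ℕ) = 0 := by
  classical
  have haeval (m : ℕ) (a : Fin m → A) :
      Polynomial.aeval b (Polynomial.ofFn m a) = ∑ j, a j • b ^ (j : ℕ) := by
    simp [Polynomial.ofFn_eq_sum_monomial, Polynomial.aeval_monomial, Algebra.smul_def]
  constructor
  · rintro ⟨p, hp, hpb⟩
    have hfn := Polynomial.ofFn_comp_toFn_eq_id_of_natDegree_lt p.natDegree.lt_succ_self
    refine ⟨p.natDegree + 1, Polynomial.toFn _ p, fun h => hp ?_, ?_⟩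
    · rw [← hfn, h, Polynomial.ofFn_zero]
    · rw [← haeval, hfn, hpb]
  · rintro ⟨m, a, ha, hab⟩
    exact ⟨Polynomial.ofFn m a, (map_ne_zero_iff _ (Polynomial.injective_ofFn m)).mpr ha,
      (haeval m a).trans hab⟩

lemma isAlgebraic_adjoin_iff_of_injective {k Z D : Type*} [CommRing k] [CommRing Z] [Ring D]
    [Algebra k Z] [Algebra k D] {f : Z →ₐ[k] D} (hf : Function.Injective f) {T : Set Z} {c : Z} :
    IsAlgebraic (Algebra.adjoin k T) c ↔ ∃ (m : ℕ) (a : Fin m → D),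
      (∀ j, a j ∈ Algebra.adjoin k (f '' T)) ∧ a ≠ 0 ∧ ∑ j, a j * f c ^ (j : ℕ) = 0 := by
  have hsum {m : ℕ} (a : Fin m → Algebra.adjoin k T) :
      ∑ j, f (a j) * f c ^ (j : ℕ) = 0 ↔ ∑ j, a j • c ^ (j : ℕ) = 0 := by
    rw [← map_eq_zero_iff f hf]
    simp [Subalgebra.smul_def]
  have hzero {m : ℕ} (a : Fin m → Algebra.adjoin k T) : (fun j => f (a j)) = 0 ↔ a = 0 := by
    simp [funext_iff, map_eq_zero_iff f hf]
  rw [isAlgebraic_iff_exists_sum_smul_pow]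
  refine exists_congr fun m => ⟨?_, ?_⟩
  · rintro ⟨a, ha, hac⟩
    refine ⟨fun j => f (a j), fun j => ?_, (hzero a).not.mpr ha, (hsum a).mpr hac⟩
    exact AlgHom.map_adjoin f T ▸ ⟨a j, (a j).2, rfl⟩
  · rintro ⟨a, ha, ha0, hac⟩
    rw [← AlgHom.map_adjoin] at ha
    choose b hb hba using ha
    obtain rfl : (fun j => f (b j)) = a := funext hba
    exact ⟨fun j => ⟨b j, hb j⟩, (hzero _).not.mp ha0, (hsum _).mp hac⟩

lemma algebraicIndependent_of_isAlgebraic_adjoin {k Z ι : Type*} [CommRing k] [CommRing Z]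
    [IsDomain Z] [Algebra k Z] [FaithfulSMul k Z] [Finite ι] {c t : ι → Z}
    (hc : AlgebraicIndependent k c)
    (h : ∀ i, IsAlgebraic (Algebra.adjoin k (Set.range t)) (c i)) : AlgebraicIndependent k t := by
  have : Nontrivial k := (algebraMap k Z).domain_nontrivial
  let M := AlgebraicIndependent.matroid k Z
  have hcM : M.Indep (Set.range c) := AlgebraicIndependent.matroid_indep_iff.mpr hc.to_subtype_range
  have hsub : Set.range c ⊆ M.closure (Set.range t) := by
    rw [AlgebraicIndependent.matroid_closure_eq]
    rintro _ ⟨i, rfl⟩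
    exact h i
  have hle : (Set.univ : Set ι).encard ≤ M.eRk (Set.range t) := by
    rw [← hc.injective.encard_image, Set.image_univ, ← hcM.eRk_eq_encard,
      ← M.eRk_closure_eq (Set.range t)]
    exact M.eRk_mono hsub
  have hcard : (Set.range t).encard ≤ (Set.univ : Set ι).encard :=
    Set.image_univ ▸ Set.encard_image_le t _
  have hind : M.Indep (Set.range t) := (M.indep_iff_eRk_eq_encard_of_finite
    (Set.finite_range t)).mpr ((M.eRk_le_encard _).antisymm (hcard.trans hle))
  have hinj : Function.Injective t := Set.injOn_univ.mp <|
    Set.finite_univ.injOn_of_encard_image_eq <| by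
      rw [Set.image_univ]
      exact hcard.antisymm (hle.trans (M.eRk_le_encard _))
  exact .of_subtype_range hinj (AlgebraicIndependent.matroid_indep_iff.mp hind)

end Algebraic

/-! ## Weyl presentations -/

section Presentation

variable {k D : Type*} [Field k] [DivisionRing D] [Algebra k D]

lemma isUnit_center_of_ne_zero {z : Subalgebra.center k D} (hz : z ≠ 0) : IsUnit z := by
  have hz' : (z : D) ≠ 0 := ZeroMemClass.coe_eq_zero.not.mpr hz
  have hinv : (z : D)⁻¹ ∈ Subalgebra.center k D := Subalgebra.mem_center_iff.mpr fun b =>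
    (Commute.inv_right₀ (Subalgebra.mem_center_iff.mp z.2 b)).eq
  exact isUnit_iff_exists.mpr ⟨⟨_, hinv⟩, Subtype.ext (mul_inv_cancel₀ hz'),
    Subtype.ext (inv_mul_cancel₀ hz')⟩

lemma exists_algHom_rationalFunctions_center {l : ℕ} {t : Fin l → Subalgebra.center k D}
    (ht : AlgebraicIndependent k t) :
    ∃ κ : RationalFunctions l k →ₐ[k] Subalgebra.center k D,
      ∀ i, κ (algebraMap (MvPolynomial (Fin l) k) _ (MvPolynomial.X i)) = t i :=
  ⟨IsLocalization.liftAlgHom (M := (MvPolynomial (Fin l) k)⁰) (f := MvPolynomial.aeval t)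
    fun y => isUnit_center_of_ne_zero
      ((map_ne_zero_iff _ ht).mpr (nonZeroDivisors.coe_ne_zero y)),
    fun i => (IsLocalization.lift_eq _ _).trans (MvPolynomial.aeval_X t i)⟩

theorem IsWeylTuple.exists_isSkewFieldOfFractions [CharZero k] {n l : ℕ} {w : Fin n ⊕ Fin n → D}
    (hw : IsWeylTuple w) {t : Fin l → Subalgebra.center k D} (ht : AlgebraicIndependent k t)
    (hgen : Subfield.closure (Set.range (algebraMap k D) ∪ Set.range w ∪
      Set.range fun i => (t i : D)) = ⊤) :
    ∃ f : WeylAlgebraRat n l k →ₐ[k] D,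
      IsSkewFieldOfFractions (f : WeylAlgebraRat n l k →+* D) ∧
        ∀ i, f (WeylAlgebra.gen i) = w i := by
  obtain ⟨κ, hκ⟩ := exists_algHom_rationalFunctions_center ht
  let : Algebra (RationalFunctions l k) D :=
    ((Subalgebra.center k D).val.comp κ : RationalFunctions l k →+* D).toAlgebra' fun a d =>
      (Subalgebra.mem_center_iff.mp (κ a).2 d).symm
  have : IsScalarTower k (RationalFunctions l k) D :=
    .of_algebraMap_eq fun a => (((Subalgebra.center k D).val.comp κ).commutes a).symm
  refine ⟨(WeylAlgebra.lift hw).restrictScalars k,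
    WeylAlgebra.isSkewFieldOfFractions_lift hw ?_, WeylAlgebra.lift_gen hw⟩
  rw [← top_le_iff, ← hgen, Subfield.closure_le]
  rintro _ ((⟨a, rfl⟩ | ⟨i, rfl⟩) | ⟨i, rfl⟩) <;> apply Subfield.subset_closure
  · exact Or.inl ⟨algebraMap k _ a, (IsScalarTower.algebraMap_apply k _ D a).symm⟩
  · exact Or.inr ⟨i, rfl⟩
  · exact Or.inl ⟨_, congrArg Subtype.val (hκ i)⟩

lemma mem_center_of_commute {S : Set D}
    (hS : Subfield.closure (Set.range (algebraMap k D) ∪ S) = ⊤) {x : D}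
    (hx : ∀ s ∈ S, Commute x s) : x ∈ Subalgebra.center k D := by
  refine Subalgebra.mem_center_iff.mpr fun d => Commute.eq (Commute.symm ?_)
  have hd : d ∈ Subfield.closure (Set.range (algebraMap k D) ∪ S) := hS ▸ Subfield.mem_top d
  induction hd using Subfield.closure_induction with
  | mem s hs =>
    obtain ⟨a, rfl⟩ | hs := hs
    exacts [Algebra.commute_algebraMap_right a x, hx s hs]
  | one => exact Commute.one_right x
  | add _ _ _ _ h₁ h₂ => exact h₁.add_right h₂
  | neg _ _ h => exact h.neg_right
  | inv _ _ h => exact h.inv_right₀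
  | mul _ _ _ _ h₁ h₂ => exact h₁.mul_right h₂

lemma IsSkewFieldOfFractions.mem_center_of_commute {A : Type*} [Ring A] {f : A →+* D}
    (hf : IsSkewFieldOfFractions f) {x : D} (hx : ∀ a, Commute x (f a)) :
    x ∈ Subalgebra.center k D := by
  refine Subalgebra.mem_center_iff.mpr fun d => ?_
  obtain ⟨a, b, -, rfl⟩ := hf.exists_frac d
  exact ((hx b).inv_right₀.mul_right (hx a)).eq.symm

lemma mem_center_of_weylAlgebraRat {n l : ℕ} {f : WeylAlgebraRat n l k →ₐ[k] D}
    (hf : IsSkewFieldOfFractions (f : WeylAlgebraRat n l k →+* D)) (a : RationalFunctions l k) :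
    f (algebraMap _ _ a) ∈ Subalgebra.center k D :=
  hf.mem_center_of_commute fun b => (Algebra.commute_algebraMap_left a b).map f

/-- The elements `w` form a Weyl tuple, and together with `t` they generate the elements `e` by left
fractions; the elements `t` commute with `e`, and the elements `c` are algebraic over `k[t]`. If the
elements `e` generate the division algebra and the elements `c` are central and algebraically
independent, this exhibits a Weyl field; each condition is a finite system of identities and
inequations, so that it can be specialized. -/
structure IsWeylPresentation {n : ℕ} {τ ι κ : Type*} (k : Type*) [Field k] [Algebra k D]
    (w : Fin n ⊕ Fin n → D) (t : τ → D) (e : ι → D) (c : κ → D) : Prop where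
  weyl : IsWeylTuple w
  commute : ∀ i j, Commute (t i) (e j)
  algebraic : ∀ i, ∃ (m : ℕ) (a : Fin m → D),
    (∀ j, a j ∈ Algebra.adjoin k (Set.range t)) ∧ a ≠ 0 ∧ ∑ j, a j * c i ^ (j : ℕ) = 0
  exists_frac : ∀ j, ∃ p ∈ Algebra.adjoin k (Set.range w ∪ Set.range t),
    ∃ q ∈ Algebra.adjoin k (Set.range w ∪ Set.range t), q ≠ 0 ∧ q * e j = p

lemma adjoin_le_subfieldClosure (k : Type*) [Field k] [Algebra k D] (S : Set D) :
    (Algebra.adjoin k S).toSubring ≤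
      (Subfield.closure (Set.range (algebraMap k D) ∪ S)).toSubring := by
  rw [Algebra.adjoin_eq_ring_closure, Subring.closure_le]
  exact Subfield.subset_closure

theorem IsWeylPresentation.exists_isSkewFieldOfFractions [CharZero k] {n l : ℕ} {ι : Type*}
    {w : Fin n ⊕ Fin n → D} {t : Fin l → D} {e : ι → D} {c : Fin l → Subalgebra.center k D}
    (h : IsWeylPresentation k w t e fun i => (c i : D)) (hc : AlgebraicIndependent k c)
    (he : Subfield.closure (Set.range (algebraMap k D) ∪ Set.range e) = ⊤) :
    ∃ f : WeylAlgebraRat n l k →ₐ[k] D,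
      IsSkewFieldOfFractions (f : WeylAlgebraRat n l k →+* D) ∧
        ∀ i, f (WeylAlgebra.gen i) = w i := by
  have ht (i : Fin l) : t i ∈ Subalgebra.center k D :=
    mem_center_of_commute he (Set.forall_mem_range.mpr (h.commute i))
  lift t to Fin l → Subalgebra.center k D using ht
  have hind : AlgebraicIndependent k t := by
    refine algebraicIndependent_of_isAlgebraic_adjoin hc fun i => ?_
    rw [isAlgebraic_adjoin_iff_of_injective (f := (Subalgebra.center k D).val)
      Subtype.val_injective, ← Set.range_comp]
    exact h.algebraic i
  refine h.weyl.exists_isSkewFieldOfFractions hind (top_le_iff.mp ?_)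
  rw [← he, Subfield.closure_le, Set.union_assoc]
  rintro _ (ha | ⟨j, rfl⟩)
  · exact Subfield.subset_closure (Or.inl ha)
  · obtain ⟨p, hp, q, hq, hq0, hqe⟩ := h.exists_frac j
    rw [← eq_inv_mul_iff_mul_eq₀ hq0] at hqe
    rw [hqe]
    exact mul_mem (inv_mem (adjoin_le_subfieldClosure k _ hq)) (adjoin_le_subfieldClosure k _ hp)

lemma isWeylGenerators_of_isSkewFieldOfFractions {A : Type*} [Ring A] [Algebra k A] [IsOreDomain A]
    {n l : ℕ} {f : WeylAlgebraRat n l k →ₐ[k] SkewFrac A}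
    (hf : IsSkewFieldOfFractions (f : WeylAlgebraRat n l k →+* SkewFrac A)) :
    IsWeylGenerators k A n fun i => f (WeylAlgebra.gen i.swap) := by
  set w : Fin n ⊕ Fin n → SkewFrac A := fun i => f (WeylAlgebra.gen i.swap)
  have hmem (a : WeylAlgebraRat n l k) : f a ∈ Algebra.adjoin k
      (Set.range w ∪ (Subalgebra.center k (SkewFrac A) : Set (SkewFrac A))) := by
    have ha : a ∈ Algebra.adjoin (RationalFunctions l k) (Set.range WeylAlgebra.gen) :=
      WeylAlgebra.adjoin_gen (K := RationalFunctions l k) ▸ Algebra.mem_top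
    induction ha using Algebra.adjoin_induction with
    | mem x hx =>
      obtain ⟨i, rfl⟩ := hx
      exact Algebra.subset_adjoin (Or.inl ⟨i.swap, by simp [w]⟩)
    | algebraMap a => exact Algebra.subset_adjoin (Or.inr (mem_center_of_weylAlgebraRat hf a))
    | add x y _ _ hx hy => exact map_add f x y ▸ add_mem hx hy
    | mul x y _ _ hx hy => exact map_mul f x y ▸ mul_mem hx hy
  have hlie (i j : Fin n ⊕ Fin n) :
      ⁅w i, w j⁆ = ((Matrix.J (Fin n) ℤ i.swap j.swap : ℤ) : SkewFrac A) := by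
    simpa [w, Ring.lie_def] using congrArg f (WeylAlgebra.isWeylTuple_gen i.swap j.swap)
  refine ⟨fun i j => ?_, fun i j => ?_, fun i j => ?_, fun d => ?_⟩
  · simpa [Ring.lie_def, Matrix.J, sub_eq_zero] using hlie (Sum.inl i) (Sum.inl j)
  · simpa [Ring.lie_def, Matrix.J, sub_eq_zero] using hlie (Sum.inr i) (Sum.inr j)
  · simpa [Ring.lie_def, Matrix.J, Matrix.one_apply] using hlie (Sum.inl i) (Sum.inr j)
  · obtain ⟨a, b, hb, hd⟩ := hf.exists_frac d
    have hb' : f b ≠ 0 := (map_ne_zero_iff f hf.injective).mpr hb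
    exact ⟨f a, hmem a, f b, hmem b, hb', (eq_inv_mul_iff_mul_eq₀ hb').mp hd⟩

section OfIsSkewFieldOfFractions

variable {n l : ℕ} {f : WeylAlgebraRat n l k →ₐ[k] D}

variable (f) in
/-- The images of the variables `t_i` of `A_n(k(t_1, …, t_l))`. -/
def weylVariable (i : Fin l) : D :=
  f (algebraMap (MvPolynomial (Fin l) k) _ (MvPolynomial.X i))

lemma map_algebraMap_mem_adjoin_weylVariable (p : MvPolynomial (Fin l) k) :
    f (algebraMap (MvPolynomial (Fin l) k) _ p) ∈
      Algebra.adjoin k (Set.range (weylVariable f)) := by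
  let g : MvPolynomial (Fin l) k →ₐ[k] D := f.comp (IsScalarTower.toAlgHom k _ _)
  have hg : g '' Set.range MvPolynomial.X = Set.range (weylVariable f) := (Set.range_comp _ _).symm
  rw [← hg, ← AlgHom.map_adjoin, MvPolynomial.adjoin_range_X]
  exact ⟨p, Algebra.mem_top, rfl⟩

lemma exists_map_mul_mem_adjoin (a : WeylAlgebraRat n l k) :
    ∃ z : MvPolynomial (Fin l) k, z ≠ 0 ∧ f (algebraMap _ _ z * a) ∈ Algebra.adjoin k
      (Set.range (fun i => f (WeylAlgebra.gen i)) ∪ Set.range (weylVariable f)) := by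
  have ha : a ∈ Submodule.span (RationalFunctions l k)
      ((Submonoid.closure (Set.range WeylAlgebra.gen) : Submonoid (WeylAlgebraRat n l k)) :
        Set (WeylAlgebraRat n l k)) := by
    rw [← Algebra.adjoin_eq_span (RationalFunctions l k),
      WeylAlgebra.adjoin_gen (K := RationalFunctions l k), Algebra.top_toSubmodule]
    exact Submodule.mem_top
  obtain ⟨⟨z, hz⟩, hza⟩ := multiple_mem_span_of_mem_localization_span
    (MvPolynomial (Fin l) k)⁰ (RationalFunctions l k) _ a ha
  refine ⟨z, nonZeroDivisors.ne_zero hz, ?_⟩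
  rw [← Algebra.adjoin_eq_span (MvPolynomial (Fin l) k), Submonoid.mk_smul] at hza
  rw [← Algebra.smul_def]
  generalize z • a = b at hza ⊢
  induction hza using Algebra.adjoin_induction with
  | mem x hx =>
    obtain ⟨i, rfl⟩ := hx
    exact Algebra.subset_adjoin (Or.inl ⟨i, rfl⟩)
  | algebraMap p =>
    exact Algebra.adjoin_mono Set.subset_union_right (map_algebraMap_mem_adjoin_weylVariable p)
  | add x y _ _ hx hy => exact map_add f x y ▸ add_mem hx hy
  | mul x y _ _ hx hy => exact map_mul f x y ▸ mul_mem hx hy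

variable (hf : IsSkewFieldOfFractions (f : WeylAlgebraRat n l k →+* D))
include hf

lemma exists_adjoin_frac (d : D) :
    ∃ p ∈ Algebra.adjoin k
      (Set.range (fun i => f (WeylAlgebra.gen i)) ∪ Set.range (weylVariable f)),
    ∃ q ∈ Algebra.adjoin k
      (Set.range (fun i => f (WeylAlgebra.gen i)) ∪ Set.range (weylVariable f)),
      q ≠ 0 ∧ q * d = p := by
  obtain ⟨a, b, hb, rfl⟩ := hf.exists_frac d
  obtain ⟨x, hx, hxa⟩ := exists_map_mul_mem_adjoin (f := f) a
  obtain ⟨y, hy, hyb⟩ := exists_map_mul_mem_adjoin (f := f) b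
  have hmem (p : MvPolynomial (Fin l) k) := Algebra.adjoin_mono (R := k)
    (Set.subset_union_right (s := Set.range fun i => f (WeylAlgebra.gen i)))
    (map_algebraMap_mem_adjoin_weylVariable (f := f) p)
  have hne {p : MvPolynomial (Fin l) k} (hp : p ≠ 0) : f (algebraMap _ _ p) ≠ 0 := by
    have hinj := (IsFractionRing.injective (MvPolynomial (Fin l) k) (RationalFunctions l k))
    exact (map_ne_zero (f.comp (IsScalarTower.toAlgHom k (RationalFunctions l k) _))).mpr
      ((map_ne_zero_iff _ hinj).mpr hp)
  have hfb : f b ≠ 0 := (map_ne_zero_iff f hf.injective).mpr hb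
  refine ⟨_, mul_mem (hmem y) hxa, _, mul_mem (hmem x) hyb, ?_, ?_⟩
  · rw [map_mul]
    exact mul_ne_zero (hne hx) (mul_ne_zero (hne hy) hfb)
  · change _ * ((f b)⁻¹ * f a) = _
    simp only [map_mul, mul_assoc, mul_inv_cancel_left₀ hfb]
    simp only [← map_mul, ← mul_assoc, (Algebra.commutes x (algebraMap _ (WeylAlgebraRat n l k) y))]

lemma exists_algebraicIndependent_weylVariable :
    ∃ t : Fin l → Subalgebra.center k D,
      AlgebraicIndependent k t ∧ ∀ i, (t i : D) = weylVariable f i := by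
  let ζ : RationalFunctions l k →ₐ[k] Subalgebra.center k D :=
    (f.comp (IsScalarTower.toAlgHom k _ _)).codRestrict _ (mem_center_of_weylAlgebraRat hf)
  have hX : AlgebraicIndependent k fun i : Fin l =>
      algebraMap (MvPolynomial (Fin l) k) (RationalFunctions l k) (MvPolynomial.X i) :=
    (MvPolynomial.algebraicIndependent_X (Fin l) k).map'
      (f := IsScalarTower.toAlgHom k _ _) (IsFractionRing.injective _ _)
  exact ⟨_, hX.map' (f := ζ) ζ.toRingHom.injective, fun _ => rfl⟩

theorem IsWeylPresentation.of_isSkewFieldOfFractions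
    (htr : Algebra.trdeg k (Subalgebra.center k D) = l) {ι κ : Type*} (e : ι → D)
    (c : κ → Subalgebra.center k D) :
    IsWeylPresentation k (fun i => f (WeylAlgebra.gen i)) (weylVariable f) e
      (fun i => (c i : D)) := by
  obtain ⟨t, hind, ht⟩ := exists_algebraicIndependent_weylVariable hf
  have hbasis : IsTranscendenceBasis k t :=
    hind.isTranscendenceBasis_of_lift_trdeg_le_of_finite (by rw [htr]; simp)
  refine ⟨fun i j => ?_, fun i j => ht i ▸ Subalgebra.mem_center_iff.mp (t i).2 (e j) |>.symm,
    fun i => ?_, fun j => exists_adjoin_frac hf (e j)⟩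
  · simpa [Ring.lie_def] using congrArg f (WeylAlgebra.isWeylTuple_gen i j)
  · have halg := hbasis.isAlgebraic.isAlgebraic (c i)
    rw [isAlgebraic_adjoin_iff_of_injective (f := (Subalgebra.center k D).val)
      Subtype.val_injective, ← Set.range_comp] at halg
    rwa [← show (Subalgebra.center k D).val ∘ t = weylVariable f from funext ht]

end OfIsSkewFieldOfFractions

end Presentation

/-! ## Spreading out Weyl presentations -/

section SpreadPresentation

open ReducedProduct

variable {Φ : Type*} {l : Filter Φ} {k : Φ → Type*} {D : Φ → Type*} [∀ φ, Field (k φ)]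
  [∀ φ, DivisionRing (D φ)] [∀ φ, Algebra (k φ) (D φ)] {k₀ D₀ : Type*} [Field k₀]
  [DivisionRing D₀] [Algebra k₀ D₀] {Θ : D₀ →+* ReducedProduct l D}

lemma ReducedProduct.eventually_commute_rep {a b : ReducedProduct l D} (h : Commute a b) :
    ∀ᶠ φ in l, Commute (a.rep φ) (b.rep φ) := by
  filter_upwards [eventually_rep_mul a b, eventually_rep_mul b a] with φ hab hba
  exact hab.symm.trans ((congrArg (rep · φ) h.eq).trans hba)

lemma IsWeylTuple.eventually_rep {n : ℕ} {w : Fin n ⊕ Fin n → ReducedProduct l D}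
    (hw : IsWeylTuple w) : ∀ᶠ φ in l, IsWeylTuple fun i => (w i).rep φ := by
  refine Filter.eventually_all.mpr fun i => Filter.eventually_all.mpr fun j => ?_
  filter_upwards [eventually_rep_lie (w i) (w j),
    eventually_rep_intCast (l := l) (D := D) (Matrix.J (Fin n) ℤ i j)] with φ hlie hJ
  rw [← hlie, hw, hJ]

lemma eventually_rep_map_ne_zero {x : D₀} (hx : x ≠ 0) : ∀ᶠ φ in l, (Θ x).rep φ ≠ 0 :=
  eventually_rep_ne_zero ((IsUnit.mk0 x hx).map Θ)

variable (hΘ : ∀ c : k₀, ∃ s : ∀ φ, k φ,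
  Θ (algebraMap k₀ D₀ c) = ReducedProduct.mk fun φ => algebraMap (k φ) (D φ) (s φ))
include hΘ

lemma eventually_rep_mem_adjoin {S : Set D₀} {x : D₀} (hx : x ∈ Algebra.adjoin k₀ S) :
    ∀ᶠ φ in l, (Θ x).rep φ ∈ Algebra.adjoin (k φ) ((fun s => (Θ s).rep φ) '' S) := by
  induction hx using Algebra.adjoin_induction with
  | mem x hx =>
    exact Filter.Eventually.of_forall fun φ => Algebra.subset_adjoin (Set.mem_image_of_mem _ hx)
  | algebraMap c =>
    obtain ⟨s, hs⟩ := hΘ c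
    filter_upwards [eventually_rep_eq_of_eq_mk hs] with φ hφ
    exact hφ ▸ Subalgebra.algebraMap_mem _ _
  | add x y _ _ hx hy =>
    filter_upwards [hx, hy, eventually_rep_add (Θ x) (Θ y)] with φ hxφ hyφ hφ
    rw [map_add, hφ]
    exact add_mem hxφ hyφ
  | mul x y _ _ hx hy =>
    filter_upwards [hx, hy, eventually_rep_mul (Θ x) (Θ y)] with φ hxφ hyφ hφ
    rw [map_mul, hφ]
    exact mul_mem hxφ hyφ

lemma eventually_algebraic_rep {τ : Type*} {t : τ → D₀} {c : D₀}
    (h : ∃ (m : ℕ) (a : Fin m → D₀),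
      (∀ j, a j ∈ Algebra.adjoin k₀ (Set.range t)) ∧ a ≠ 0 ∧ ∑ j, a j * c ^ (j : ℕ) = 0) :
    ∀ᶠ φ in l, ∃ (m : ℕ) (a : Fin m → D φ),
      (∀ j, a j ∈ Algebra.adjoin (k φ) (Set.range fun i => (Θ (t i)).rep φ)) ∧ a ≠ 0 ∧
        ∑ j, a j * (Θ c).rep φ ^ (j : ℕ) = 0 := by
  obtain ⟨m, a, ha, ha0, hac⟩ := h
  obtain ⟨j, hj⟩ := Function.ne_iff.mp ha0
  have hsum := eventually_rep_sum_mul_pow (fun j => Θ (a j)) (Θ c)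
  simp only [← map_pow, ← map_mul, ← map_sum, hac] at hsum
  filter_upwards [Filter.eventually_all.mpr fun j => eventually_rep_mem_adjoin hΘ (ha j),
    eventually_rep_map_ne_zero (Θ := Θ) hj, hsum,
    eventually_rep_eq_of_eq_mk (f := 0) (map_zero Θ)] with φ hmem hne hsumφ hzero
  refine ⟨m, fun j => (Θ (a j)).rep φ, fun j => ?_, Function.ne_iff.mpr ⟨j, hne⟩,
    hsumφ.symm.trans hzero⟩
  exact Set.range_comp (fun s => (Θ s).rep φ) t ▸ hmem j

lemma eventually_exists_frac_rep {S : Set D₀} {e : D₀}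
    (h : ∃ p ∈ Algebra.adjoin k₀ S, ∃ q ∈ Algebra.adjoin k₀ S, q ≠ 0 ∧ q * e = p) :
    ∀ᶠ φ in l, ∃ p ∈ Algebra.adjoin (k φ) ((fun s => (Θ s).rep φ) '' S),
      ∃ q ∈ Algebra.adjoin (k φ) ((fun s => (Θ s).rep φ) '' S),
        q ≠ 0 ∧ q * (Θ e).rep φ = p := by
  obtain ⟨_, hp, q, hq, hq0, rfl⟩ := h
  filter_upwards [eventually_rep_mem_adjoin hΘ hp, eventually_rep_mem_adjoin hΘ hq,
    eventually_rep_map_ne_zero (Θ := Θ) hq0, eventually_rep_mul (Θ q) (Θ e)] with φ hpφ hqφ hq0φ hφ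
  exact ⟨_, hpφ, _, hqφ, hq0φ, by rw [map_mul, hφ]⟩

theorem IsWeylPresentation.eventually_rep {n : ℕ} {τ ι κ : Type*} [Finite τ] [Finite ι] [Finite κ]
    {w : Fin n ⊕ Fin n → D₀} {t : τ → D₀} {e : ι → D₀} {c : κ → D₀}
    (h : IsWeylPresentation k₀ w t e c) :
    ∀ᶠ φ in l, IsWeylPresentation (k φ) (fun i => (Θ (w i)).rep φ) (fun i => (Θ (t i)).rep φ)
      (fun j => (Θ (e j)).rep φ) fun i => (Θ (c i)).rep φ := by
  have hweyl : IsWeylTuple fun i => Θ (w i) := fun i j => by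
    simpa [Ring.lie_def] using congrArg Θ (h.weyl i j)
  filter_upwards [hweyl.eventually_rep,
    Filter.eventually_all.mpr fun i => Filter.eventually_all.mpr fun j =>
      eventually_commute_rep ((h.commute i j).map Θ),
    Filter.eventually_all.mpr fun i => eventually_algebraic_rep hΘ (h.algebraic i),
    Filter.eventually_all.mpr fun j => eventually_exists_frac_rep hΘ (h.exists_frac j)]
    with φ hw ht hc he
  refine ⟨hw, ht, hc, fun j => ?_⟩
  simpa only [Set.image_union, ← Set.range_comp, Function.comp_def] using he j

end SpreadPresentation

/-! ## Locally closed subvarieties over the integers -/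

section Variety

lemma nonempty_algHom_of_finiteType {K : Type*} [Field K] (C : Type*) [CommRing C] [Nontrivial C]
    [Algebra K C] [Algebra.FiniteType K C] (k : Type*) [Field k] [IsAlgClosed k] [Algebra K k] :
    Nonempty (C →ₐ[K] k) := by
  obtain ⟨M, hM⟩ := Ideal.exists_maximal C
  let : Field (C ⧸ M) := Ideal.Quotient.field M
  have : Algebra.FiniteType K (C ⧸ M) :=
    .of_surjective (Ideal.Quotient.mkₐ K M) (Ideal.Quotient.mkₐ_surjective K M)
  have : Module.Finite K (C ⧸ M) := finite_of_finite_type_of_isJacobsonRing K (C ⧸ M)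
  exact ⟨(IsAlgClosed.lift (R := K) (S := C ⧸ M) (M := k)).comp (Ideal.Quotient.mkₐ K M)⟩

lemma nonempty_integralLocallyClosed {N : ℕ} {F G : Finset (MvPolynomial (Fin N) ℤ)} {K : Type*}
    [Field K] [CharZero K] (h : (integralLocallyClosed F G K).Nonempty) (k : Type*) [Field k]
    [IsAlgClosed k] [CharZero k] : (integralLocallyClosed F G k).Nonempty := by
  obtain ⟨z, hzF, g, hg, hgz⟩ := h
  let B : Subalgebra ℚ K := Algebra.adjoin ℚ (insert (MvPolynomial.aeval z g)⁻¹ (Set.range z))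
  have hB : B.FG := Subalgebra.fg_def.mpr ⟨_, (Set.finite_range z).insert _, rfl⟩
  have : Algebra.FiniteType ℚ B := B.fg_iff_finiteType.mp hB
  obtain ⟨ψ⟩ := nonempty_algHom_of_finiteType (K := ℚ) B k
  let z' (i : Fin N) : B := ⟨z i, Algebra.subset_adjoin (Set.mem_insert_of_mem _ ⟨i, rfl⟩)⟩
  have hz' (p : MvPolynomial (Fin N) ℤ) : (MvPolynomial.aeval z' p : K) = MvPolynomial.aeval z p :=
    MvPolynomial.comp_aeval_apply z' (B.val.restrictScalars ℤ) p
  have hψ (p : MvPolynomial (Fin N) ℤ) :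
      MvPolynomial.aeval (fun i => ψ (z' i)) p = ψ (MvPolynomial.aeval z' p) :=
    (MvPolynomial.comp_aeval_apply z' (ψ.restrictScalars ℤ) p).symm
  refine ⟨fun i => ψ (z' i), fun f hf => ?_, g, hg, ?_⟩
  · rw [hψ, ZeroMemClass.coe_eq_zero.mp ((hz' f).trans (hzF f hf)), map_zero]
  · let u : B := ⟨(MvPolynomial.aeval z g)⁻¹, Algebra.subset_adjoin (Set.mem_insert _ _)⟩
    have hu : MvPolynomial.aeval z' g * u = 1 :=
      Subtype.ext ((congrArg (· * _) (hz' g)).trans (mul_inv_cancel₀ hgz))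
    rw [hψ]
    exact ((IsUnit.of_mul_eq_one u hu).map ψ).ne_zero

lemma mem_integralLocallyClosed_iff_forall {ι : Type*} {N : ℕ}
    [DecidableEq (MvPolynomial (Fin N) ℤ)] (S : Finset ι) (C : ι → Prop) [DecidablePred C]
    (p : ι → MvPolynomial (Fin N) ℤ) {k : Type*} [Field k] {z : Fin N → k} :
    z ∈ integralLocallyClosed ({i ∈ S | C i}.image p) {∏ i ∈ S with ¬ C i, p i} k ↔
      ∀ i ∈ S, MvPolynomial.aeval z (p i) = 0 ↔ C i := by
  simp only [integralLocallyClosed, Set.mem_ofPred_eq, Finset.forall_mem_image, Finset.mem_filter,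
    and_imp, Finset.mem_singleton, exists_eq_left, map_prod, Finset.prod_ne_zero_iff]
  exact ⟨fun h i hi => ⟨not_imp_not.mp (h.2 i hi), h.1 hi⟩, fun h =>
    ⟨fun i hi => (h i hi).mpr, fun i hi => mt (h i hi).mp⟩⟩

namespace GeometricPoint

lemma exists_finset_of_eventually_generic {P : Type*} [CommRing P] {k₀ : Type u} [Field k₀]
    {η : P →ₐ[ℤ] k₀} {Q : GeometricPoint.{u} P → Prop} (hQ : ∀ᶠ φ in generic η, Q φ) :
    ∃ S : Finset P, ∀ φ : GeometricPoint.{u} P,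
      (∀ p ∈ S, φ.toAlgHom p = 0 ↔ η p = 0) → Q φ := by
  obtain ⟨S, hS, hSQ⟩ := (Filter.hasBasis_iInf_principal_finite _).mem_iff.mp hQ
  exact ⟨hS.toFinset, fun φ hφ => hSQ <| Set.mem_iInter₂.mpr fun p hp =>
    hφ p (hS.mem_toFinset.mpr hp)⟩

lemma exists_integralLocallyClosed_iff {σ K : Type*} [Field K]
    (η : MvPolynomial σ ℤ →ₐ[ℤ] K) (S : Finset (MvPolynomial σ ℤ)) :
    ∃ (N : ℕ) (F G : Finset (MvPolynomial (Fin N) ℤ))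
      (π : MvPolynomial σ ℤ →ₐ[ℤ] MvPolynomial (Fin N) ℤ),
      (integralLocallyClosed F G K).Nonempty ∧ ∀ (k : Type u) [Field k] (z : Fin N → k),
        z ∈ integralLocallyClosed F G k ↔
          ∀ p ∈ S, MvPolynomial.aeval z (π p) = 0 ↔ η p = 0 := by
  classical
  let T : Finset σ := S.biUnion MvPolynomial.vars
  let e : Fin T.card → σ := fun i => T.equivFin.symm i
  have he : Function.Injective e := Subtype.val_injective.comp T.equivFin.symm.injective
  have hT {p : MvPolynomial σ ℤ} (hp : p ∈ S) : (p.vars : Set σ) ⊆ Set.range e := fun i hi =>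
    ⟨T.equivFin ⟨i, Finset.mem_biUnion.mpr ⟨p, hp, hi⟩⟩, by simp [e]⟩
  let π := MvPolynomial.killCompl (R := ℤ) he
  have hπ {p : MvPolynomial σ ℤ} (hp : p ∈ S) :
      MvPolynomial.aeval (fun i => η (MvPolynomial.X (e i))) (π p) = η p := by
    obtain ⟨q, rfl⟩ := MvPolynomial.exists_rename_eq_of_vars_subset_range p e he (hT hp)
    rw [MvPolynomial.killCompl_rename_app, MvPolynomial.aeval_unique η, MvPolynomial.aeval_rename]
    simp [Function.comp_def]
  refine ⟨_, _, _, π, ⟨fun i => η (MvPolynomial.X (e i)), ?_⟩, fun k _ z =>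
    mem_integralLocallyClosed_iff_forall S (η · = 0) π⟩
  exact (mem_integralLocallyClosed_iff_forall S (η · = 0) π).mpr fun p hp => by rw [hπ hp]

lemma exists_integralLocallyClosed_of_eventually_generic {σ : Type*} {k₀ : Type u} [Field k₀]
    [CharZero k₀] {η : MvPolynomial σ ℤ →ₐ[ℤ] k₀}
    {Q : GeometricPoint.{u} (MvPolynomial σ ℤ) → Prop} (hQ : ∀ᶠ φ in generic η, Q φ) :
    ∃ (N : ℕ) (F G : Finset (MvPolynomial (Fin N) ℤ))
      (π : MvPolynomial σ ℤ →ₐ[ℤ] MvPolynomial (Fin N) ℤ),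
      ∀ (k : Type u) [Field k] [IsAlgClosed k] [CharZero k],
        (integralLocallyClosed F G k).Nonempty ∧
          ∀ z ∈ integralLocallyClosed F G k, Q ⟨k, (MvPolynomial.aeval z).comp π⟩ := by
  obtain ⟨S, hS⟩ := exists_finset_of_eventually_generic hQ
  obtain ⟨N, F, G, π, hne, hX⟩ := exists_integralLocallyClosed_iff.{u} η S
  exact ⟨N, F, G, π, fun k _ _ _ => ⟨nonempty_integralLocallyClosed hne k,
    fun z hz => hS _ ((hX k z).mp hz)⟩⟩

end GeometricPoint

end Variety

/-! ## Families of base changes in characteristic zero -/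

lemma IsSkewFieldOfFractions.subfieldClosure_eq_top {k A D : Type*} [Field k] [Ring A] [Algebra k A]
    [DivisionRing D] [Algebra k D] {f : A →ₐ[k] D} (hf : IsSkewFieldOfFractions (f : A →+* D))
    {S : Set A} (hS : Algebra.adjoin k S = ⊤) :
    Subfield.closure (Set.range (algebraMap k D) ∪ f '' S) = ⊤ := by
  refine top_unique fun d _ => hf.mem_subfield (fun a => adjoin_le_subfieldClosure k (f '' S) ?_) d
  rw [← AlgHom.map_adjoin, hS]
  exact ⟨a, Algebra.mem_top, rfl⟩

/-- The embedding of a `k`-algebra into its skew field of fractions, as a homomorphism of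
`k`-algebras. -/
def SkewFrac.ofAlgHom (k A : Type*) [Field k] [Ring A] [Algebra k A] [IsOreDomain A] :
    A →ₐ[k] SkewFrac A :=
  { SkewFrac.of A with commutes' := fun _ => rfl }

lemma SkewFrac.subfieldClosure_of_one_tmul_eq_top {R : Type*} [Ring R] {S : Set R}
    (hS : Algebra.adjoin ℤ S = ⊤) (k : Type*) [Field k] [IsOreDomain (k ⊗[ℤ] R)] :
    Subfield.closure (Set.range (algebraMap k (SkewFrac (k ⊗[ℤ] R))) ∪
      Set.range fun r : S => SkewFrac.of (k ⊗[ℤ] R) (1 ⊗ₜ (r : R))) = ⊤ := by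
  have hgen := (SkewFrac.isSkewFieldOfFractions_of (k ⊗[ℤ] R)).subfieldClosure_eq_top
    (f := SkewFrac.ofAlgHom k (k ⊗[ℤ] R))
    (Algebra.TensorProduct.adjoin_one_tmul_image_eq_top (A := k) S hS)
  rw [Set.image_image, Set.image_eq_range] at hgen
  exact hgen

lemma SkewFrac.of_mem_center {k A : Type*} [Field k] [Ring A] [Algebra k A] [IsOreDomain A]
    {z : A} (hz : z ∈ Subalgebra.center k A) :
    SkewFrac.of A z ∈ Subalgebra.center k (SkewFrac A) :=
  (SkewFrac.isSkewFieldOfFractions_of A).mem_center_of_commute fun a =>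
    Commute.map (show Commute z a from (Subalgebra.mem_center_iff.mp hz a).symm) (SkewFrac.of A)

lemma SkewFrac.exists_algebraicIndependent_center {k A ι : Type*} [Field k] [Ring A] [Algebra k A]
    [IsOreDomain A] {x : ι → Subalgebra.center k A} (hx : AlgebraicIndependent k x) :
    ∃ c : ι → Subalgebra.center k (SkewFrac A),
      AlgebraicIndependent k c ∧ ∀ i, (c i : SkewFrac A) = SkewFrac.of A (x i) := by
  let g : Subalgebra.center k A →ₐ[k] Subalgebra.center k (SkewFrac A) :=
    ((SkewFrac.ofAlgHom k A).comp (Subalgebra.center k A).val).codRestrict _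
      fun z => SkewFrac.of_mem_center z.2
  exact ⟨fun i => g (x i), hx.map' (f := g) fun a b hab => Subtype.ext <|
    (SkewFrac.isSkewFieldOfFractions_of A).injective (congrArg Subtype.val hab), fun i => rfl⟩

lemma trdeg_fractionRing (k Z : Type*) [Field k] [CommRing Z] [IsDomain Z] [Algebra k Z] :
    Algebra.trdeg k (FractionRing Z) = Algebra.trdeg k Z := by
  have : Algebra.IsAlgebraic Z (FractionRing Z) :=
    IsFractionRing.comap_isAlgebraic_iff (K := FractionRing Z).mpr inferInstance
  rw [← trdeg_add_eq k Z (A := FractionRing Z), trdeg_eq_zero (R := Z), add_zero]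

/-- The part of `IsZCompatible` that matters for the Gelfand–Kirillov Conjecture: in characteristic
zero, the transcendence degree of `Frac A_k` does not depend on `k`, and that of the centre is the
same for `A_k` and `Frac A_k` and is attained by finitely many elements of `A_ℤ`. -/
structure IsCharZeroCompatible (R : Type v) [Ring R] [IsGeometricallyOre.{u} R] : Prop where
  finiteType : Algebra.FiniteType ℤ R
  exists_gkTdeg_eq : ∃ d : EReal, ∀ (k : Type u) [Field k] [IsAlgClosed k] [CharZero k],
    gkTdeg k (SkewFrac (k ⊗[ℤ] R)) = d
  trdeg_center : ∀ (k : Type u) [Field k] [IsAlgClosed k] [CharZero k],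
    Algebra.trdeg k (Subalgebra.center k (SkewFrac (k ⊗[ℤ] R))) =
      Algebra.trdeg k (Subalgebra.center k (k ⊗[ℤ] R))
  exists_isTranscendenceBasis : ∃ (s : ℕ) (x : Fin s → R),
    ∀ (k : Type u) [Field k] [IsAlgClosed k] [CharZero k],
      ∃ hx : ∀ i, (1 : k) ⊗ₜ[ℤ] x i ∈ Subalgebra.center k (k ⊗[ℤ] R),
        IsTranscendenceBasis k fun i =>
          (⟨(1 : k) ⊗ₜ[ℤ] x i, hx i⟩ : Subalgebra.center k (k ⊗[ℤ] R))

lemma IsCharZeroCompatible.exists_center_generators {R : Type v} [Ring R] [IsGeometricallyOre.{u} R]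
    (hR : IsCharZeroCompatible.{u} R) :
    ∃ (s : ℕ) (x : Fin s → R), ∀ (k : Type u) [Field k] [IsAlgClosed k] [CharZero k],
      Algebra.trdeg k (FractionRing (Subalgebra.center k (k ⊗[ℤ] R))) = s ∧
      Algebra.trdeg k (Subalgebra.center k (SkewFrac (k ⊗[ℤ] R))) = s ∧
      ∃ c : Fin s → Subalgebra.center k (SkewFrac (k ⊗[ℤ] R)), AlgebraicIndependent k c ∧
        ∀ i, (c i : SkewFrac (k ⊗[ℤ] R)) = SkewFrac.of _ (1 ⊗ₜ x i) := by
  obtain ⟨s, x, hx⟩ := hR.exists_isTranscendenceBasis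
  refine ⟨s, x, fun k _ _ _ => ?_⟩
  obtain ⟨hxc, hbasis⟩ := hx k
  have htr : Algebra.trdeg k (Subalgebra.center k (k ⊗[ℤ] R)) = s := by
    simpa using hbasis.lift_cardinalMk_eq_trdeg.symm
  exact ⟨(trdeg_fractionRing k _).trans htr, (hR.trdeg_center k).trans htr,
    SkewFrac.exists_algebraicIndependent_center hbasis.1⟩

namespace IsIntegralFiltration

variable {R : Type v} [Ring R] {F : ℕ → Submodule ℤ R}

lemma finrank_baseChange (hF : IsIntegralFiltration.{u} R F) (k : Type u) [Field k]
    [IsAlgClosed k] : Module.finrank k ((F 1).baseChange k) = Module.finrank ℤ (F 1) := by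
  have := hF.free 1 le_rfl
  have := hF.finite 1 le_rfl
  calc Module.finrank k ((F 1).baseChange k)
      = Module.finrank k (k ⊗[ℤ] F 1) := (LinearEquiv.ofInjective ((F 1).subtype.baseChange k)
          (hF.baseChange_injective k 1)).finrank_eq.symm
    _ = Module.finrank ℤ (F 1) := Module.finrank_baseChange

lemma finiteType (hF : IsIntegralFiltration.{u} R F) : Algebra.FiniteType ℤ R := by
  obtain ⟨S, hS⟩ := Module.Finite.iff_fg.mp (hF.finite 1 le_rfl)
  have hle : F 1 ≤ Subalgebra.toSubmodule (Algebra.adjoin ℤ (S : Set R)) :=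
    hS ▸ Algebra.span_le_adjoin ℤ _
  refine ⟨S, top_unique fun r _ => ?_⟩
  obtain ⟨i, hi⟩ := hF.exhaustive r
  have hr : r ∈ F 1 ^ (i + 1) := hF.pow (i + 1) (Nat.le_add_left 1 i) ▸ hF.mono (Nat.le_succ i) hi
  have hpow : F 1 ^ (i + 1) ≤ Subalgebra.toSubmodule (Algebra.adjoin ℤ (S : Set R)) :=
    (pow_le_pow_left' hle _).trans_eq ((Subalgebra.isIdempotentElem_toSubmodule _).pow_succ_eq i)
  exact hpow hr

end IsIntegralFiltration

namespace IsZCompatible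

variable {R : Type v} [Ring R] (hR : IsZCompatible.{u, v} R)
include hR

lemma exists_gkTdeg_eq : ∃ d : EReal, ∀ (k : Type u) [Field k] [IsAlgClosed k],
    haveI := hR.isOreDomain k
    gkTdeg k (SkewFrac (k ⊗[ℤ] R)) = d := by
  obtain ⟨F, hF, h | h⟩ := hR.exists_filtration
  · exact ⟨(Module.finrank ℤ (F 1) : ℕ), fun k _ _ => hF.finrank_baseChange k ▸ h k⟩
  · refine ⟨((Module.finrank ℤ (F 1) : ℕ) : EReal) - 1, fun k _ _ => ?_⟩
    rw [← hF.finrank_baseChange k, ← h k]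
    exact (EReal.add_sub_cancel_right (b := 1)).symm

lemma isGeometricallyOre : IsGeometricallyOre.{u} R :=
  ⟨fun k => hR.isOreDomain k⟩

theorem isCharZeroCompatible :
    haveI := hR.isGeometricallyOre
    IsCharZeroCompatible.{u} R := by
  have := hR.isGeometricallyOre
  obtain ⟨d, hd⟩ := hR.exists_gkTdeg_eq
  obtain ⟨s, x, hx, -⟩ := hR.center_polynomial
  refine ⟨?_, ⟨d, fun k => hd k⟩, fun k _ _ _ => ?_, s, x, fun k _ _ _ => ?_⟩
  · obtain ⟨F, hF, -⟩ := hR.exists_filtration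
    exact hF.finiteType
  · obtain ⟨f⟩ := hR.center_skewFrac k
    exact f.trdeg_eq.trans (trdeg_fractionRing k _)
  · obtain ⟨hxc, hbij⟩ := hx k
    refine ⟨hxc, ?_⟩
    let e : MvPolynomial (Fin s) k ≃ₐ[k] Subalgebra.center k (k ⊗[ℤ] R) := .ofBijective _ hbij
    convert AlgEquiv.isTranscendenceBasis (A' := Subalgebra.center k (k ⊗[ℤ] R)) e
      (.mvPolynomial (Fin s) k) using 1
    ext i
    simp [e]

end IsZCompatible

/-! ## Specialization of Weyl generators -/

section Specialization

variable {R : Type v} [Ring R] [IsGeometricallyOre.{u} R] {P : Type*} [CommRing P]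
  {k₀ : Type u} [Field k₀] [IsAlgClosed k₀] [CharZero k₀] {η : P →ₐ[ℤ] k₀}
  {Θ : SkewFrac (k₀ ⊗[ℤ] R) →+*
    ReducedProduct (GeometricPoint.generic.{u} η) fun φ => SkewFrac (φ.k ⊗[ℤ] R)}
  (hΘ : ∀ x, Θ (SkewFrac.of _ (Algebra.TensorProduct.map η (AlgHom.id ℤ R) x)) =
    ReducedProduct.mk fun φ => SkewFrac.of _ (φ.baseChange R x))
include hΘ

namespace GeometricPoint

lemma exists_map_algebraMap_eq_mk (hη : Function.Surjective η) (c : k₀) :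
    ∃ s : ∀ φ : GeometricPoint.{u} P, φ.k, Θ (algebraMap k₀ (SkewFrac (k₀ ⊗[ℤ] R)) c) =
      ReducedProduct.mk fun φ => algebraMap φ.k (SkewFrac (φ.k ⊗[ℤ] R)) (s φ) := by
  obtain ⟨p, rfl⟩ := hη c
  exact ⟨fun φ => φ.toAlgHom p, hΘ (p ⊗ₜ 1)⟩

lemma eventually_rep_map_of_one_tmul (r : R) : ∀ᶠ φ in generic.{u} η,
    (Θ (SkewFrac.of _ (1 ⊗ₜ r))).rep φ = SkewFrac.of (φ.k ⊗[ℤ] R) (1 ⊗ₜ r) := by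
  have h := hΘ (1 ⊗ₜ r)
  simp only [baseChange, Algebra.TensorProduct.map_tmul, map_one, AlgHom.id_apply] at h
  exact ReducedProduct.eventually_rep_eq_of_eq_mk h

lemma exists_eventually_rep_eq_inv_mul (hη : Function.Surjective η) (d : SkewFrac (k₀ ⊗[ℤ] R)) :
    ∃ a b : P ⊗[ℤ] R, ∀ᶠ φ in generic.{u} η, φ.baseChange R b ≠ 0 ∧
      (Θ d).rep φ = (SkewFrac.of _ (φ.baseChange R b))⁻¹ * SkewFrac.of _ (φ.baseChange R a) := by
  obtain ⟨a, b, hb, hd⟩ := (SkewFrac.isSkewFieldOfFractions_of _).exists_frac d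
  have hsurj : Function.Surjective (Algebra.TensorProduct.map η (AlgHom.id ℤ R)) :=
    TensorProduct.map_surjective hη Function.surjective_id
  obtain ⟨a, rfl⟩ := hsurj a
  obtain ⟨b, rfl⟩ := hsurj b
  have hmul : Θ (SkewFrac.of _ (Algebra.TensorProduct.map η (AlgHom.id ℤ R) b)) * Θ d =
      ReducedProduct.mk fun φ => SkewFrac.of _ (φ.baseChange R a) := by
    rw [← RingHom.map_mul, (eq_inv_mul_iff_mul_eq₀ (SkewFrac.isUnit_of hb).ne_zero).mp hd, hΘ a]
  refine ⟨a, b, ?_⟩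
  filter_upwards [eventually_baseChange_eq_zero_iff η b,
    ReducedProduct.eventually_rep_eq_of_eq_mk (hΘ b), ReducedProduct.eventually_rep_mul _ (Θ d),
    ReducedProduct.eventually_rep_eq_of_eq_mk hmul] with φ hφb hb_rep hmul_rep hφ
  have hb' : φ.baseChange R b ≠ 0 := mt hφb.mp hb
  refine ⟨hb', (eq_inv_mul_iff_mul_eq₀ (SkewFrac.isUnit_of hb').ne_zero).mpr ?_⟩
  rw [← hb_rep, ← hmul_rep, hφ]

end GeometricPoint

theorem IsCharZeroCompatible.eventually_exists_isSkewFieldOfFractions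
    (hR : IsCharZeroCompatible.{u} R) (hη : Function.Surjective η) {n l : ℕ}
    (htr : Algebra.trdeg k₀ (Subalgebra.center k₀ (SkewFrac (k₀ ⊗[ℤ] R))) = l)
    {f : WeylAlgebraRat n l k₀ →ₐ[k₀] SkewFrac (k₀ ⊗[ℤ] R)}
    (hf : IsSkewFieldOfFractions (f : WeylAlgebraRat n l k₀ →+* SkewFrac (k₀ ⊗[ℤ] R))) :
    ∀ᶠ φ in GeometricPoint.generic.{u} η,
      ∃ g : WeylAlgebraRat n l φ.k →ₐ[φ.k] SkewFrac (φ.k ⊗[ℤ] R),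
        IsSkewFieldOfFractions (g : WeylAlgebraRat n l φ.k →+* SkewFrac (φ.k ⊗[ℤ] R)) ∧
          ∀ i, g (WeylAlgebra.gen i) = (Θ (f (WeylAlgebra.gen i))).rep φ := by
  obtain ⟨s, x, hx⟩ := hR.exists_center_generators
  obtain rfl : s = l := Nat.cast_injective ((hx k₀).2.1.symm.trans htr)
  obtain ⟨S, hS⟩ := hR.finiteType.out
  obtain ⟨c, -, hcx⟩ := (hx k₀).2.2
  have hpres := IsWeylPresentation.of_isSkewFieldOfFractions hf htr
    (fun r : S => SkewFrac.of _ ((1 : k₀) ⊗ₜ[ℤ] (r : R))) c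
  simp only [hcx] at hpres
  have hpres_rep := hpres.eventually_rep (Θ := Θ)
    (GeometricPoint.exists_map_algebraMap_eq_mk hΘ hη)
  filter_upwards [hpres_rep,
    Filter.eventually_all.mpr fun r : S => GeometricPoint.eventually_rep_map_of_one_tmul hΘ (r : R),
    Filter.eventually_all.mpr fun i => GeometricPoint.eventually_rep_map_of_one_tmul hΘ (x i)]
    with φ hφ hS_rep hx_rep
  obtain ⟨cφ, hind, hcφ⟩ := (hx φ.k).2.2
  simp only [hS_rep, hx_rep, ← hcφ] at hφ
  exact hφ.exists_isSkewFieldOfFractions hind (SkewFrac.subfieldClosure_of_one_tmul_eq_top hS φ.k)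

end Specialization

theorem IsCharZeroCompatible.exists_eventually_isWeylGenerators {R : Type v} [Ring R]
    [IsGeometricallyOre.{u} R] (hR : IsCharZeroCompatible.{u} R) {P : Type*} [CommRing P]
    {k₀ : Type u} [Field k₀] [IsAlgClosed k₀] [CharZero k₀] {η : P →ₐ[ℤ] k₀}
    (hη : Function.Surjective η) (hGK : GelfandKirillovHolds k₀ (k₀ ⊗[ℤ] R)) :
    ∃ (m : ℕ) (a b : Fin m ⊕ Fin m → P ⊗[ℤ] R), ∀ᶠ φ in GeometricPoint.generic.{u} η,
      GelfandKirillovHolds φ.k (φ.k ⊗[ℤ] R) ∧ (∀ i, φ.baseChange R (b i) ≠ 0) ∧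
        IsWeylGenerators φ.k (φ.k ⊗[ℤ] R) m fun i =>
          (SkewFrac.of _ (φ.baseChange R (b i)))⁻¹ * SkewFrac.of _ (φ.baseChange R (a i)) := by
  obtain ⟨m, l, hdeg, htr, f, hf⟩ := hGK
  obtain ⟨s, x, hx⟩ := hR.exists_center_generators
  obtain rfl : s = l := Nat.cast_injective ((hx k₀).1.symm.trans htr)
  obtain ⟨d, hd⟩ := hR.exists_gkTdeg_eq
  obtain ⟨Θ, hΘ⟩ := GeometricPoint.exists_hom_reducedProduct R hη
  choose a b hab using fun i : Fin m ⊕ Fin m =>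
    GeometricPoint.exists_eventually_rep_eq_inv_mul hΘ hη (f (WeylAlgebra.gen i.swap))
  refine ⟨m, a, b, ?_⟩
  filter_upwards [hR.eventually_exists_isSkewFieldOfFractions hΘ hη (hx k₀).2.1 hf,
    Filter.eventually_all.mpr hab] with φ ⟨g, hg, hgen⟩ habφ
  refine ⟨⟨m, s, (hd φ.k).trans ((hd k₀).symm.trans hdeg), (hx φ.k).1, g, hg⟩,
    fun i => (habφ i).1, ?_⟩
  convert isWeylGenerators_of_isSkewFieldOfFractions hg using 2 with i
  rw [hgen, (habφ i).2]

lemma specialize_map_eq_baseChange (R : Type v) [Ring R] {P : Type*} [CommRing P] {N : ℕ}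
    (π : P →ₐ[ℤ] MvPolynomial (Fin N) ℤ) {k : Type u} [Field k] [IsAlgClosed k] [CharZero k]
    (z : Fin N → k) (x : P ⊗[ℤ] R) :
    specialize R z (Algebra.TensorProduct.map π (AlgHom.id ℤ R) x) =
      GeometricPoint.baseChange ⟨k, (MvPolynomial.aeval z).comp π⟩ R x := by
  have h := Algebra.TensorProduct.map_comp (MvPolynomial.aeval z) π (AlgHom.id ℤ R) (AlgHom.id ℤ R)
  exact (DFunLike.congr_fun h x).symm

lemma integralLocallyClosed_empty {N : ℕ} (F : Finset (MvPolynomial (Fin N) ℤ)) (k : Type*)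
    [Field k] : integralLocallyClosed F ∅ k = ∅ :=
  Set.eq_empty_of_forall_notMem fun _ ⟨_, _, hg, _⟩ => Finset.notMem_empty _ hg

theorem mainTheorem9_general (R : Type v) [Ring R] [IsGeometricallyOre.{u} R]
    (hR : IsCharZeroCompatible.{u} R) :
    ∃ (N : ℕ) (F G : Finset (MvPolynomial (Fin N) ℤ)) (m : ℕ)
      (a b : Fin m ⊕ Fin m → MvPolynomial (Fin N) ℤ ⊗[ℤ] R),
      ∀ (k : Type u) [Field k] [IsAlgClosed k] [CharZero k],
        (GelfandKirillovHolds k (k ⊗[ℤ] R) ↔ (integralLocallyClosed F G k).Nonempty) ∧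
        ∀ z ∈ integralLocallyClosed F G k,
          (∀ i, specialize R z (b i) ≠ 0) ∧
          IsWeylGenerators k (k ⊗[ℤ] R) m (fun i =>
            (SkewFrac.of (k ⊗[ℤ] R) (specialize R z (b i)))⁻¹ *
              SkewFrac.of (k ⊗[ℤ] R) (specialize R z (a i))) := by
  by_cases hex : ∃ (k₀ : Type u) (_ : Field k₀) (_ : IsAlgClosed k₀) (_ : CharZero k₀),
      GelfandKirillovHolds k₀ (k₀ ⊗[ℤ] R)
  · obtain ⟨k₀, _, _, _, hGK⟩ := hex
    have hη : Function.Surjective (MvPolynomial.aeval id : MvPolynomial k₀ ℤ →ₐ[ℤ] k₀) :=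
      fun c => ⟨MvPolynomial.X c, MvPolynomial.aeval_X id c⟩
    obtain ⟨m, a, b, hab⟩ := hR.exists_eventually_isWeylGenerators hη hGK
    obtain ⟨N, F, G, π, hX⟩ :=
      GeometricPoint.exists_integralLocallyClosed_of_eventually_generic hab
    let ρ := Algebra.TensorProduct.map π (AlgHom.id ℤ R)
    refine ⟨N, F, G, m, fun i => ρ (a i), fun i => ρ (b i), fun k _ _ _ => ?_⟩
    obtain ⟨hne, hXk⟩ := hX k
    refine ⟨iff_of_true (hne.elim fun z hz => (hXk z hz).1) hne, fun z hz => ?_⟩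
    have hρ (x) : specialize R z (ρ x) = _ := specialize_map_eq_baseChange R π z x
    simp only [hρ]
    exact (hXk z hz).2
  · refine ⟨0, ∅, ∅, 0, 0, 0, fun k _ _ _ => ?_⟩
    rw [integralLocallyClosed_empty]
    have hk : ¬GelfandKirillovHolds k (k ⊗[ℤ] R) :=
      fun h => hex ⟨k, inferInstance, inferInstance, inferInstance, h⟩
    exact ⟨iff_of_false hk Set.not_nonempty_empty, fun z hz => hz.elim⟩

end

theorem mainTheorem9 (R : Type v) [Ring R] (hR : IsZCompatible.{u, v} R) :
    ∃ (N : ℕ) (F G : Finset (MvPolynomial (Fin N) ℤ)) (m : ℕ)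
      (a b : Fin m ⊕ Fin m → MvPolynomial (Fin N) ℤ ⊗[ℤ] R),
      ∀ (k : Type u) [Field k] [IsAlgClosed k] [CharZero k],
        haveI : IsOreDomain (k ⊗[ℤ] R) := hR.isOreDomain k
        (GelfandKirillovHolds k (k ⊗[ℤ] R) ↔ (integralLocallyClosed F G k).Nonempty) ∧
        ∀ z ∈ integralLocallyClosed F G k,
          (∀ i, specialize R z (b i) ≠ 0) ∧
          IsWeylGenerators k (k ⊗[ℤ] R) m (fun i =>
            (SkewFrac.of (k ⊗[ℤ] R) (specialize R z (b i)))⁻¹ *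
              SkewFrac.of (k ⊗[ℤ] R) (specialize R z (a i))) := by
  have := hR.isGeometricallyOre
  exact mainTheorem9_general R hR.isCharZeroCompatible
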